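/- Let $M$ be a smooth manifold and let $\tau: Z\to M$ be a one-dimensional vectorially trivial affine bundle, that is, a smooth affine bundle modelled on the trivial vector bundle $M\times\mathbb{R}$. Write $(t,z)\mapsto z+t$ for the resulting action of $\mathbb{R}$ on $Z$, $\mathrm{Sec}(Z)$ for the set of smooth sections of $\tau$ (an affine space modelled on $C^\infty(M)$), and $\mathrm{AffDer}(Z,\mathbb{R})$ for the $C^\infty(M)$-module of affine derivations, i.e. affine maps $D:\mathrm{Sec}(Z)\to C^\infty(M)$, $D(\sigma+f)=D(\sigma)+\widehat{D}(f)$, whose linear part $\widehat{D}$ is a derivation of the algebra $C^\infty(M)$; it carries the Lie bracket $$[D_1,D_2]=\widehat{D}_1\circ D_2-\widehat{D}_2\circ D_1 .$$ Let $\widetilde{\mathbb{T}}Z=\mathbb{T}Z/\mathbb{R}$ be the reduced tangent bundle, i.e. the space of orbits of the induced $\mathbb{R}$-action on $\mathbb{T}Z$. It is a vector bundle over $M$ whose smooth sections are identified with the $\mathbb{R}$-invariant vector fields on $Z$, and it is a Lie algebroid: the bracket of sections is the Lie bracket of the corresponding invariant vector fields, and the anchor $\widetilde\tau:\widetilde{\mathbb{T}}Z\to\mathbb{T}M$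 is induced by $\mathbb{T}\tau$. For $\sigma\in\mathrm{Sec}(Z)$ let $f_\sigma: Z\to\mathbb{R}$ be the affine function $f_\sigma(z)=\sigma(\tau(z))-z$. Theorem 1. There is exactly one isomorphism of $C^\infty(M)$-modules $X\mapsto D_X$ from the sections of $\widetilde{\mathbb{T}}Z$ onto $\mathrm{AffDer}(Z,\mathbb{R})$ with the following properties: (1) it is an isomorphism of Lie algebras, $D_{[X,Y]}=[D_X,D_Y]$; (2) $D_X(\sigma)\circ\tau=X(f_\sigma)$ for every section $\sigma$ of $Z$, where on the right $X$ is regarded as an invariant vector field on $Z$; (3) the linear part of $D_X$ is the derivation given by the vector field $\widetilde\tau\circ X$ on $M$; (4) the fundamental vector field $X_0$ of the action, $X_0(z)=\frac{d}{dt}\big|_{t=0}(z-t)$, corresponds to the affine derivation $\mathrm{Sec}(Z)\ni\sigma\mapsto 1_M$ with vanishing linear part. -/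

import Mathlib

open scoped Manifold ContDiff

set_option linter.unusedSectionVars false

/-- A one-dimensional vectorially trivial affine bundle `τ : Z → M`, i.e. a smooth affine bundle
modelled on the trivial vector bundle `M × ℝ`.  The affine structure of the fibres is recorded by
the translations `(t, z) ↦ t +ᵥ z` (written `z + t` in mathematical notation), which make each fibre of `τ`
an affine space modelled on `ℝ`; locally over `M` the bundle is isomorphic, as an affine bundle
with model bundle `M × ℝ`, to `U × ℝ`. -/
class AffineLineBundle (E F : Type*) [NormedAddCommGroup E] [NormedSpace ℝ E]
    [NormedAddCommGroup F] [NormedSpace ℝ F]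
    {M Z : Type*} [TopologicalSpace M] [ChartedSpace E M] [TopologicalSpace Z] [ChartedSpace F Z]
    [AddAction ℝ Z] (τ : Z → M) : Prop where
  contMDiff_proj : ContMDiff 𝓘(ℝ, F) 𝓘(ℝ, E) ∞ τ
  contMDiff_vadd : ContMDiff (𝓘(ℝ, ℝ).prod 𝓘(ℝ, F)) 𝓘(ℝ, F) ∞ (fun p : ℝ × Z => p.1 +ᵥ p.2)
  proj_vadd : ∀ (t : ℝ) (z : Z), τ (t +ᵥ z) = τ z
  existsUnique_vadd : ∀ z w : Z, τ z = τ w → ∃! t : ℝ, t +ᵥ z = w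
  exists_trivialization : ∀ p : M, ∃ e : Bundle.Trivialization ℝ τ, p ∈ e.baseSet ∧
    ContMDiffOn 𝓘(ℝ, F) (𝓘(ℝ, E).prod 𝓘(ℝ, ℝ)) ∞ e e.source ∧
    ContMDiffOn (𝓘(ℝ, E).prod 𝓘(ℝ, ℝ)) 𝓘(ℝ, F) ∞ e.toOpenPartialHomeomorph.symm e.target ∧
    ∀ (t : ℝ), ∀ z ∈ e.source, (e (t +ᵥ z)).2 = t + (e z).2

namespace AffineLineBundle

section Basic

variable (E F : Type*) [NormedAddCommGroup E] [NormedSpace ℝ E]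
  [NormedAddCommGroup F] [NormedSpace ℝ F]
  {M Z : Type*} [TopologicalSpace M] [ChartedSpace E M] [TopologicalSpace Z] [ChartedSpace F Z]
  [AddAction ℝ Z] (τ : Z → M)

theorem proj_surjective [AffineLineBundle E F τ] : Function.Surjective τ := by
  intro p
  obtain ⟨e, hp, -⟩ := exists_trivialization (E := E) (F := F) (τ := τ) p
  exact ⟨_, e.proj_symm_apply' (x := 0) hp⟩

theorem contMDiff_translate [AffineLineBundle E F τ] (t : ℝ) :
    ContMDiff 𝓘(ℝ, F) 𝓘(ℝ, F) ∞ (fun z : Z => t +ᵥ z) :=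
  (contMDiff_vadd (E := E) (F := F) (τ := τ)).comp
    (contMDiff_const.prodMk contMDiff_id : ContMDiff 𝓘(ℝ, F) (𝓘(ℝ, ℝ).prod 𝓘(ℝ, F)) ∞
      (fun z : Z => (t, z)))

theorem vadd_cancel [AffineLineBundle E F τ] {t s : ℝ} {z : Z} (h : t +ᵥ z = s +ᵥ z) : t = s :=
  (existsUnique_vadd E F (τ := τ) z (s +ᵥ z) (proj_vadd E F (τ := τ) s z).symm).unique h rfl

open Classical in
/-- The difference `w - z ∈ ℝ` of two points of the same fibre of `τ`
(and `0` if they lie in different fibres). -/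
noncomputable def diff (w z : Z) : ℝ :=
  if h : ∃ t : ℝ, t +ᵥ z = w then h.choose else 0

theorem diff_vadd [AffineLineBundle E F τ] {w z : Z} (h : τ z = τ w) : diff w z +ᵥ z = w := by
  have h' := (existsUnique_vadd E F (τ := τ) z w h).exists
  rw [diff, dif_pos h']
  exact h'.choose_spec

theorem diff_eq [AffineLineBundle E F τ] {w z : Z} {t : ℝ} (h : t +ᵥ z = w) : diff w z = t := by
  apply vadd_cancel E F τ (z := z)
  rw [h]
  exact diff_vadd E F τ (by rw [← h, proj_vadd E F (τ := τ)])

/-! ### Sections -/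

/-- The set `Sec(Z)` of smooth sections of `τ`. -/
structure Sec where
  toFun : M → Z
  proj_toFun : ∀ p, τ (toFun p) = p
  contMDiff_toFun : ContMDiff 𝓘(ℝ, E) 𝓘(ℝ, F) ∞ toFun

variable {E F τ}

instance : CoeFun (Sec E F τ) (fun _ => M → Z) := ⟨Sec.toFun⟩

@[ext] theorem Sec.ext {σ σ' : Sec E F τ} (h : ∀ p, σ p = σ' p) : σ = σ' := by
  cases σ; cases σ'; congr; exact funext h

variable [AffineLineBundle E F τ]

/-- Smooth functions act on sections: `(σ + f)(p) = σ(p) + f(p)`.  This is the structure of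
affine space of `Sec(Z)`. -/
noncomputable instance : AddAction C^∞⟮𝓘(ℝ, E), M; ℝ⟯ (Sec E F τ) where
  vadd f σ :=
    { toFun := fun p => f p +ᵥ σ p
      proj_toFun := fun p => by rw [proj_vadd E F (τ := τ), σ.proj_toFun]
      contMDiff_toFun := (contMDiff_vadd (E := E) (F := F) (τ := τ)).comp
        (f.contMDiff.prodMk σ.contMDiff_toFun) }
  zero_vadd σ := Sec.ext fun p => zero_vadd ℝ (σ p)
  add_vadd f g σ := Sec.ext fun p => add_vadd (f p) (g p) (σ p)

theorem Sec.vadd_apply (f : C^∞⟮𝓘(ℝ, E), M; ℝ⟯) (σ : Sec E F τ) (p : M) :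
    (f +ᵥ σ) p = f p +ᵥ σ p := rfl

/-- The function `f_σ` on `Z` associated with a section `σ`, `f_σ(z) = σ(τ z) - z`. It is the
affine function with directional coefficient `-1` which vanishes on the image of `σ`. -/
noncomputable def Sec.affineFunction (σ : Sec E F τ) (z : Z) : ℝ := diff (σ (τ z)) z

/-! ### Affine derivations -/

variable (E F τ) in
/-- `AffDer(Z, ℝ)`: the affine maps `Sec(Z) → C^∞(M)` whose linear part is a derivation of the
algebra `C^∞(M)`. -/
structure AffDer where
  toFun : Sec E F τ → C^∞⟮𝓘(ℝ, E), M; ℝ⟯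
  linear : Derivation ℝ C^∞⟮𝓘(ℝ, E), M; ℝ⟯ C^∞⟮𝓘(ℝ, E), M; ℝ⟯
  map_vadd : ∀ (f : C^∞⟮𝓘(ℝ, E), M; ℝ⟯) (σ : Sec E F τ), toFun (f +ᵥ σ) = linear f + toFun σ

namespace AffDer

instance : CoeFun (AffDer E F τ) (fun _ => Sec E F τ → C^∞⟮𝓘(ℝ, E), M; ℝ⟯) := ⟨AffDer.toFun⟩

@[ext] theorem ext {D D' : AffDer E F τ} (h : ∀ σ, D σ = D' σ) (h' : D.linear = D'.linear) :
    D = D' := by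
  cases D; cases D'; congr; exact funext h

noncomputable instance : Zero (AffDer E F τ) := ⟨⟨0, 0, fun f σ => by simp⟩⟩
noncomputable instance : Add (AffDer E F τ) :=
  ⟨fun D D' => ⟨D.toFun + D'.toFun, D.linear + D'.linear, fun f σ => by
    simp only [Pi.add_apply, map_vadd, Derivation.add_apply]; abel⟩⟩
noncomputable instance : Neg (AffDer E F τ) :=
  ⟨fun D => ⟨-D.toFun, -D.linear, fun f σ => by
    simp only [Pi.neg_apply, map_vadd, Derivation.neg_apply]; abel⟩⟩

/-- `(f D)(σ) = f · D(σ)`, for `f ∈ C^∞(M)`. -/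
noncomputable instance : SMul C^∞⟮𝓘(ℝ, E), M; ℝ⟯ (AffDer E F τ) :=
  ⟨fun f D => ⟨fun σ => f * D σ, f • D.linear, fun g σ => by
    simp only [map_vadd, Derivation.smul_apply, smul_eq_mul, mul_add]⟩⟩

@[simp] theorem zero_toFun (σ : Sec E F τ) : (0 : AffDer E F τ) σ = 0 := rfl
@[simp] theorem add_toFun (D D' : AffDer E F τ) (σ : Sec E F τ) : (D + D') σ = D σ + D' σ := rfl
@[simp] theorem neg_toFun (D : AffDer E F τ) (σ : Sec E F τ) : (-D) σ = -D σ := rfl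
@[simp] theorem smul_toFun (f : C^∞⟮𝓘(ℝ, E), M; ℝ⟯) (D : AffDer E F τ) (σ : Sec E F τ) :
    (f • D) σ = f * D σ := rfl
@[simp] theorem zero_linear : (0 : AffDer E F τ).linear = 0 := rfl
@[simp] theorem add_linear (D D' : AffDer E F τ) : (D + D').linear = D.linear + D'.linear := rfl
@[simp] theorem neg_linear (D : AffDer E F τ) : (-D).linear = -D.linear := rfl
@[simp] theorem smul_linear (f : C^∞⟮𝓘(ℝ, E), M; ℝ⟯) (D : AffDer E F τ) :
    (f • D).linear = f • D.linear := rfl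

noncomputable instance : AddCommGroup (AffDer E F τ) where
  add_assoc a b c := by ext1 <;> simp [add_assoc]
  zero_add a := by ext1 <;> simp
  add_zero a := by ext1 <;> simp
  neg_add_cancel a := by ext1 <;> simp
  add_comm a b := by ext1 <;> simp [add_comm]
  nsmul := nsmulRec
  zsmul := zsmulRec

noncomputable instance : Module C^∞⟮𝓘(ℝ, E), M; ℝ⟯ (AffDer E F τ) where
  one_smul D := by ext1 <;> simp
  mul_smul f g D := by ext1 <;> simp [mul_assoc, mul_smul]
  smul_zero f := by ext1 <;> simp
  smul_add f D D' := by ext1 <;> simp [mul_add]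
  add_smul f g D := by ext1 <;> simp [add_mul, add_smul]
  zero_smul D := by ext1 <;> simp

/-- The bracket `[D₁, D₂] = D̂₁ ∘ D₂ - D̂₂ ∘ D₁` of affine derivations, where `D̂` is the linear
part of `D`. -/
noncomputable instance : Bracket (AffDer E F τ) (AffDer E F τ) :=
  ⟨fun D₁ D₂ =>
    { toFun := fun σ => D₁.linear (D₂ σ) - D₂.linear (D₁ σ)
      linear := ⁅D₁.linear, D₂.linear⁆
      map_vadd := fun f σ => by
        simp only [map_vadd, map_add, Derivation.commutator_apply]; abel }⟩

@[simp] theorem lie_toFun (D₁ D₂ : AffDer E F τ) (σ : Sec E F τ) :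
    ⁅D₁, D₂⁆ σ = D₁.linear (D₂ σ) - D₂.linear (D₁ σ) := rfl
@[simp] theorem lie_linear (D₁ D₂ : AffDer E F τ) :
    ⁅D₁, D₂⁆.linear = ⁅D₁.linear, D₂.linear⁆ := rfl

noncomputable instance : LieRing (AffDer E F τ) where
  add_lie a b c := by
    ext1
    · simp only [lie_toFun, add_linear, add_toFun, Derivation.add_apply, map_add]; abel
    · ext1 f
      simp only [lie_linear, add_linear, Derivation.commutator_apply, Derivation.add_apply, map_add]
      abel
  lie_add a b c := by
    ext1
    · simp only [lie_toFun, add_linear, add_toFun, Derivation.add_apply, map_add]; abel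
    · ext1 f
      simp only [lie_linear, add_linear, Derivation.commutator_apply, Derivation.add_apply, map_add]
      abel
  lie_self a := by ext1 <;> simp
  leibniz_lie a b c := by
    ext1
    · simp only [lie_toFun, lie_linear, add_toFun, Derivation.commutator_apply, map_sub]; abel
    · ext1 f
      simp only [lie_linear, add_linear, Derivation.commutator_apply, Derivation.add_apply, map_sub]
      abel

end AffDer

end Basic

/-! ### The reduced tangent bundle -/

section Reduced

variable (E F : Type*) [NormedAddCommGroup E] [NormedSpace ℝ E]
  [NormedAddCommGroup F] [NormedSpace ℝ F]
  {M Z : Type*} [TopologicalSpace M] [ChartedSpace E M] [TopologicalSpace Z] [ChartedSpace F Z]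
  [IsManifold 𝓘(ℝ, F) ∞ Z]
  [AddAction ℝ Z] (τ : Z → M)

/-- The action `ψ_*` of `ℝ` on `TZ` induced by the translations of `Z`. -/
noncomputable def tangentTranslate (t : ℝ) (v : TangentBundle 𝓘(ℝ, F) Z) :
    TangentBundle 𝓘(ℝ, F) Z :=
  tangentMap 𝓘(ℝ, F) 𝓘(ℝ, F) (fun z : Z => t +ᵥ z) v

theorem tangentTranslate_mk (t : ℝ) (z : Z) (v : TangentSpace 𝓘(ℝ, F) z) :
    tangentTranslate F t ⟨z, v⟩ =
      ⟨t +ᵥ z, mfderiv 𝓘(ℝ, F) 𝓘(ℝ, F) (fun z : Z => t +ᵥ z) z v⟩ := rfl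

theorem tangentTranslate_zero (v : TangentBundle 𝓘(ℝ, F) Z) : tangentTranslate F (0 : ℝ) v = v := by
  have : (fun z : Z => (0 : ℝ) +ᵥ z) = id := by ext z; simp
  simp only [tangentTranslate, this, tangentMap_id]; rfl

theorem tangentTranslate_add [AffineLineBundle E F τ] (t s : ℝ) (v : TangentBundle 𝓘(ℝ, F) Z) :
    tangentTranslate F (t + s) v = tangentTranslate F t (tangentTranslate F s v) := by
  have : (fun z : Z => (t + s) +ᵥ z) = (fun z : Z => t +ᵥ z) ∘ (fun z : Z => s +ᵥ z) := by
    ext z; simp [add_vadd]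
  have h := tangentMap_comp (I := 𝓘(ℝ, F)) (I' := 𝓘(ℝ, F)) (I'' := 𝓘(ℝ, F))
    ((contMDiff_translate E F τ t).mdifferentiable (by simp))
    ((contMDiff_translate E F τ s).mdifferentiable (by simp))
  rw [← this] at h
  exact congrFun h v

theorem contMDiff_tangentTranslate [AffineLineBundle E F τ] :
    ContMDiff (𝓘(ℝ, ℝ).prod 𝓘(ℝ, F).tangent) 𝓘(ℝ, F).tangent ∞
      (fun p : ℝ × TangentBundle 𝓘(ℝ, F) Z => tangentTranslate F p.1 p.2) := by
  have hψ := contMDiff_vadd (E := E) (F := F) (τ := τ)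
  have h₀ : ContMDiff 𝓘(ℝ, ℝ) 𝓘(ℝ, ℝ).tangent ∞
      (fun t : ℝ => (⟨t, 0⟩ : TangentBundle 𝓘(ℝ, ℝ) ℝ)) := Bundle.contMDiff_zeroSection ℝ _
  have h := (hψ.contMDiff_tangentMap (m := ∞) le_rfl).comp
    (contMDiff_equivTangentBundleProd_symm.comp
      ((h₀.comp contMDiff_fst).prodMk contMDiff_snd) :
      ContMDiff (𝓘(ℝ, ℝ).prod 𝓘(ℝ, F).tangent) (𝓘(ℝ, ℝ).prod 𝓘(ℝ, F)).tangent ∞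
      (fun p : ℝ × TangentBundle 𝓘(ℝ, F) Z =>
        (equivTangentBundleProd 𝓘(ℝ, ℝ) ℝ 𝓘(ℝ, F) Z).symm (⟨p.1, 0⟩, p.2)))
  refine h.congr ?_
  rintro ⟨t, ⟨z, v⟩⟩
  change F at v
  have h' := mfderiv_prod_eq_add_apply (p := (t, z)) (v := ((0 : ℝ), v))
    (hψ.mdifferentiable (by simp) _)
  have h₁ : mfderiv 𝓘(ℝ, ℝ) 𝓘(ℝ, F) (fun s : ℝ => s +ᵥ z) t 0 = 0 := map_zero _
  have h'' := h'.trans ((congrArg (fun u : F =>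
    @HAdd.hAdd F F F _ u (mfderiv 𝓘(ℝ, F) 𝓘(ℝ, F) (fun z : Z => t +ᵥ z) z v)) h₁).trans (zero_add _))
  exact congrArg (fun u : F => (⟨t +ᵥ z, u⟩ : TangentBundle 𝓘(ℝ, F) Z)) h''.symm

theorem isInvertible_translate [AffineLineBundle E F τ] (t : ℝ) (z : Z) :
    (mfderiv 𝓘(ℝ, F) 𝓘(ℝ, F) (fun z : Z => t +ᵥ z) z).IsInvertible := by
  have : ContMDiffVAdd 𝓘(ℝ, ℝ) 𝓘(ℝ, F) ∞ ℝ Z := ⟨contMDiff_vadd (E := E) (F := F) (τ := τ)⟩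
  exact ⟨(Diffeomorph.vadd 𝓘(ℝ, ℝ) 𝓘(ℝ, F) ∞ t).mfderivToContinuousLinearEquiv (by simp) z, rfl⟩

/-- Two vectors of `TZ` are equivalent if they lie in the same orbit of `ψ_*`. -/
def orbitSetoid [AffineLineBundle E F τ] : Setoid (TangentBundle 𝓘(ℝ, F) Z) where
  r v w := ∃ t : ℝ, tangentTranslate F t v = w
  iseqv :=
    { refl := fun v => ⟨0, tangentTranslate_zero F v⟩
      symm := by
        rintro v w ⟨t, rfl⟩
        exact ⟨-t, by rw [← tangentTranslate_add E F τ, neg_add_cancel, tangentTranslate_zero]⟩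
      trans := by
        rintro u v w ⟨t, rfl⟩ ⟨s, rfl⟩
        exact ⟨s + t, tangentTranslate_add E F τ s t u⟩ }

/-- The smooth `ψ_*`-invariant vector fields on `Z`. -/
structure InvariantField [AffineLineBundle E F τ] where
  toFun : ∀ z : Z, TangentSpace 𝓘(ℝ, F) z
  contMDiff_toFun : ContMDiff 𝓘(ℝ, F) 𝓘(ℝ, F).tangent ∞
    (fun z => (⟨z, toFun z⟩ : TangentBundle 𝓘(ℝ, F) Z))
  invariant : ∀ (t : ℝ) (z : Z),
    mfderiv 𝓘(ℝ, F) 𝓘(ℝ, F) (fun z : Z => t +ᵥ z) z (toFun z) = toFun (t +ᵥ z)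

variable [AffineLineBundle E F τ]

/-- The reduced tangent bundle `T̃Z = TZ / ℝ`: the space of orbits of `ψ_*`. -/
def ReducedTangent : Type _ := Quotient (orbitSetoid E F τ)

/-- The class of a tangent vector of `Z` in the reduced tangent bundle. -/
def ReducedTangent.mk (v : TangentBundle 𝓘(ℝ, F) Z) : ReducedTangent E F τ :=
  Quotient.mk (orbitSetoid E F τ) v

theorem ReducedTangent.mk_translate (t : ℝ) (v : TangentBundle 𝓘(ℝ, F) Z) :
    mk E F τ (tangentTranslate F t v) = mk E F τ v :=
  (Quotient.sound (s := orbitSetoid E F τ) ⟨t, rfl⟩).symm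

variable {E F τ}

/-- The bundle projection `T̃Z → M`. -/
def ReducedTangent.proj (w : ReducedTangent E F τ) : M :=
  Quotient.lift (s := orbitSetoid E F τ) (fun v => τ v.proj)
    (by rintro v w ⟨t, rfl⟩; exact (proj_vadd E F t v.proj).symm) w

/-- The projection `τ̃ : T̃Z → TM` induced by `τ`: it is the anchor of the Lie algebroid `T̃Z`. -/
noncomputable def ReducedTangent.anchor (w : ReducedTangent E F τ) : TangentBundle 𝓘(ℝ, E) M :=
  Quotient.lift (s := orbitSetoid E F τ) (fun v => tangentMap 𝓘(ℝ, F) 𝓘(ℝ, E) τ v)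
    (by
      rintro v w ⟨t, rfl⟩
      have h : τ ∘ (fun z : Z => t +ᵥ z) = τ := funext (proj_vadd E F t)
      have h' := tangentMap_comp (I := 𝓘(ℝ, F)) (I' := 𝓘(ℝ, F)) (I'' := 𝓘(ℝ, E))
        ((contMDiff_proj (E := E) (F := F) (τ := τ)).mdifferentiable (by simp))
        ((contMDiff_translate E F τ t).mdifferentiable (by simp))
      rw [h] at h'
      exact congrFun h' v) w

variable (E F τ) in
/-- The set of smooth sections of the reduced tangent bundle.  As for every quotient by a smooth
free proper action, a map into `T̃Z` is smooth when locally it lifts to a smooth map into `TZ`. -/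
structure ReducedSection where
  toFun : M → ReducedTangent E F τ
  proj_toFun : ∀ p, (toFun p).proj = p
  smooth_toFun : ∀ p : M, ∃ U ∈ nhds p, ∃ l : M → TangentBundle 𝓘(ℝ, F) Z,
    ContMDiffOn 𝓘(ℝ, E) 𝓘(ℝ, F).tangent ∞ l U ∧ ∀ q ∈ U, ReducedTangent.mk E F τ (l q) = toFun q

instance : CoeFun (ReducedSection E F τ) (fun _ => M → ReducedTangent E F τ) :=
  ⟨ReducedSection.toFun⟩

@[ext] theorem ReducedSection.ext {X Y : ReducedSection E F τ} (h : ∀ p, X p = Y p) : X = Y := by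
  cases X; cases Y; congr; exact funext h

/-! ### The Lie ring of invariant vector fields -/

namespace InvariantField

instance : CoeFun (InvariantField E F τ) (fun _ => ∀ z : Z, TangentSpace 𝓘(ℝ, F) z) :=
  ⟨InvariantField.toFun⟩

@[ext] theorem ext {X Y : InvariantField E F τ} (h : ∀ z, X z = Y z) : X = Y := by
  cases X; cases Y; congr; exact funext h

noncomputable instance : Zero (InvariantField E F τ) :=
  ⟨⟨0, Bundle.contMDiff_zeroSection ℝ _, fun t z => by simp⟩⟩
noncomputable instance : Add (InvariantField E F τ) :=
  ⟨fun X Y => ⟨X.toFun + Y.toFun, X.contMDiff_toFun.add_section Y.contMDiff_toFun, fun t z => by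
    simp only [Pi.add_apply, map_add, invariant]⟩⟩
noncomputable instance : Neg (InvariantField E F τ) :=
  ⟨fun X => ⟨-X.toFun, X.contMDiff_toFun.neg_section, fun t z => by
    simp only [Pi.neg_apply, map_neg, invariant]⟩⟩

/-- `(f X)(z) = f(τ z) X(z)`, for `f ∈ C^∞(M)`. -/
noncomputable instance : SMul C^∞⟮𝓘(ℝ, E), M; ℝ⟯ (InvariantField E F τ) :=
  ⟨fun f X => ⟨fun z => f (τ z) • X z,
    (f.contMDiff.comp (contMDiff_proj (E := E) (F := F) (τ := τ))).smul_section X.contMDiff_toFun,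
    fun t z => by simp only [map_smul, invariant, proj_vadd E F (τ := τ)]⟩⟩

@[simp] theorem zero_apply (z : Z) : (0 : InvariantField E F τ) z = 0 := rfl
@[simp] theorem add_apply (X Y : InvariantField E F τ) (z : Z) : (X + Y) z = X z + Y z := rfl
@[simp] theorem neg_apply (X : InvariantField E F τ) (z : Z) : (-X) z = -X z := rfl
@[simp] theorem smul_apply (f : C^∞⟮𝓘(ℝ, E), M; ℝ⟯) (X : InvariantField E F τ) (z : Z) :
    (f • X) z = f (τ z) • X z := rfl

noncomputable instance : AddCommGroup (InvariantField E F τ) where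
  add_assoc a b c := by ext1; simp [add_assoc]
  zero_add a := by ext1; simp
  add_zero a := by ext1; simp
  neg_add_cancel a := by ext1; simp
  add_comm a b := by ext1; simp [add_comm]
  nsmul := nsmulRec
  zsmul := zsmulRec

noncomputable instance : Module C^∞⟮𝓘(ℝ, E), M; ℝ⟯ (InvariantField E F τ) where
  one_smul D := by ext1; simp
  mul_smul f g D := by ext1; simp [mul_smul]
  smul_zero f := by ext1; simp
  smul_add f D D' := by ext1; simp
  add_smul f g D := by ext1; simp [add_smul]
  zero_smul D := by ext1; simp

theorem mpullback_translate (X : InvariantField E F τ) (t : ℝ) :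
    VectorField.mpullback 𝓘(ℝ, F) 𝓘(ℝ, F) (fun z : Z => t +ᵥ z) X = X := by
  ext z
  rw [VectorField.mpullback_apply, (isInvertible_translate E F τ t z).inverse_apply_eq,
    X.invariant]

variable (E F τ) in
/-- The fundamental vector field `X₀` of the `ℝ`-action, `X₀(z) = d/dt (z - t)` at `t = 0`, that is
`X₀ = -∂/∂s` in affine coordinates. -/
noncomputable def fundamental : InvariantField E F τ where
  toFun z := mfderiv 𝓘(ℝ, ℝ) 𝓘(ℝ, F) (fun t : ℝ => (-t) +ᵥ z) 0 (1 : ℝ)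
  contMDiff_toFun := by
    have hψ : ContMDiff (𝓘(ℝ, ℝ).prod 𝓘(ℝ, F)) 𝓘(ℝ, F) ∞ (fun p : ℝ × Z => (-p.1) +ᵥ p.2) :=
      (contMDiff_vadd (E := E) (F := F) (τ := τ)).comp
        ((contDiff_neg.contMDiff.comp contMDiff_fst).prodMk contMDiff_snd)
    have h₀ : ContMDiff 𝓘(ℝ, F) 𝓘(ℝ, F).tangent ∞
        (fun z : Z => (⟨z, 0⟩ : TangentBundle 𝓘(ℝ, F) Z)) := Bundle.contMDiff_zeroSection ℝ _
    have h := (hψ.contMDiff_tangentMap (m := ∞) le_rfl).comp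
      (contMDiff_equivTangentBundleProd_symm.comp
        ((contMDiff_const (c := (⟨0, (1 : ℝ)⟩ : TangentBundle 𝓘(ℝ, ℝ) ℝ))).prodMk h₀) :
        ContMDiff 𝓘(ℝ, F) (𝓘(ℝ, ℝ).prod 𝓘(ℝ, F)).tangent ∞
        (fun z : Z => (equivTangentBundleProd 𝓘(ℝ, ℝ) ℝ 𝓘(ℝ, F) Z).symm (⟨0, (1 : ℝ)⟩, ⟨z, 0⟩)))
    refine h.congr ?_
    intro z
    have hz : ∀ (w : Z) (v : F), w = z → (⟨z, v⟩ : TangentBundle 𝓘(ℝ, F) Z) = ⟨w, v⟩ := by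
      rintro w v rfl; rfl
    refine (hz ((-0 : ℝ) +ᵥ z) _ (by simp)).trans ?_
    have h' := mfderiv_prod_eq_add_apply (p := ((0 : ℝ), z)) (v := ((1 : ℝ), (0 : F)))
      (hψ.mdifferentiable (by simp) _)
    have h₁ : mfderiv 𝓘(ℝ, F) 𝓘(ℝ, F) (fun w : Z => (-0 : ℝ) +ᵥ w) z 0 = 0 := map_zero _
    have h'' := h'.trans ((congrArg (fun u : F =>
      @HAdd.hAdd F F F _ (mfderiv 𝓘(ℝ, ℝ) 𝓘(ℝ, F) (fun t : ℝ => (-t) +ᵥ z) 0 (1 : ℝ)) u)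
      h₁).trans (add_zero _))
    exact congrArg (fun u : F => (⟨(-0 : ℝ) +ᵥ z, u⟩ : TangentBundle 𝓘(ℝ, F) Z)) h''.symm
  invariant t z := by
    have h₁ : MDifferentiableAt 𝓘(ℝ, ℝ) 𝓘(ℝ, F) (fun s : ℝ => (-s) +ᵥ z) 0 :=
      ((contMDiff_vadd (E := E) (F := F) (τ := τ)).comp
        (contDiff_neg.contMDiff.prodMk contMDiff_const :
          ContMDiff 𝓘(ℝ, ℝ) (𝓘(ℝ, ℝ).prod 𝓘(ℝ, F)) ∞
          (fun s : ℝ => (-s, z)))).mdifferentiable (by simp) 0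
    have h₂ : (fun s : ℝ => (-s) +ᵥ (t +ᵥ z)) = (fun z : Z => t +ᵥ z) ∘ (fun s : ℝ => (-s) +ᵥ z) := by
      ext s; simp only [Function.comp_apply, vadd_vadd, add_comm]
    rw [h₂, mfderiv_comp (I' := 𝓘(ℝ, F)) 0
      ((contMDiff_translate E F τ t).mdifferentiable (by simp) _) h₁]
    have hz : ∀ w : Z, w = z → (mfderiv 𝓘(ℝ, F) 𝓘(ℝ, F) (fun z : Z => t +ᵥ z) z : F → F) =
        (mfderiv 𝓘(ℝ, F) 𝓘(ℝ, F) (fun z : Z => t +ᵥ z) w : F → F) := by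
      rintro w rfl; rfl
    exact congrFun (hz ((-0 : ℝ) +ᵥ z) (by simp)) _

variable [FiniteDimensional ℝ F]

/-- The Lie bracket of invariant vector fields, as vector fields on `Z`. -/
noncomputable instance : Bracket (InvariantField E F τ) (InvariantField E F τ) :=
  ⟨fun X Y =>
    { toFun := VectorField.mlieBracket 𝓘(ℝ, F) X Y
      contMDiff_toFun := fun z => by
        have := FiniteDimensional.complete ℝ F
        have : IsManifold 𝓘(ℝ, F) (minSmoothness ℝ 2) Z := by
          rw [minSmoothness_of_isRCLikeNormedField]; infer_instance
        have : IsManifold 𝓘(ℝ, F) (((⊤ : ℕ∞) : ℕ∞ω) + 1) Z :=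
          inferInstanceAs (IsManifold 𝓘(ℝ, F) ∞ Z)
        exact ContMDiffAt.mlieBracket_vectorField (n := ⊤) (m := ⊤)
          (X.contMDiff_toFun z) (Y.contMDiff_toFun z) (by simp)
      invariant := fun t z => by
        have := FiniteDimensional.complete ℝ F
        have : IsManifold 𝓘(ℝ, F) (minSmoothness ℝ 2) Z := by
          rw [minSmoothness_of_isRCLikeNormedField]; infer_instance
        have hX := X.mpullback_translate t
        have hY := Y.mpullback_translate t
        have h := VectorField.mpullback_mlieBracket (x₀ := z)
          (X.contMDiff_toFun.mdifferentiable (by simp) (t +ᵥ z))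
          (Y.contMDiff_toFun.mdifferentiable (by simp) (t +ᵥ z))
          (contMDiff_translate E F τ t z)
          (by rw [minSmoothness_of_isRCLikeNormedField]; exact ENat.LEInfty.out)
        rw [hX, hY, VectorField.mpullback_apply,
          (isInvertible_translate E F τ t z).inverse_apply_eq] at h
        exact h.symm }⟩

@[simp] theorem lie_apply (X Y : InvariantField E F τ) (z : Z) :
    ⁅X, Y⁆ z = VectorField.mlieBracket 𝓘(ℝ, F) X Y z := rfl

noncomputable instance : LieRing (InvariantField E F τ) where
  add_lie a b c := by
    ext1 z
    have := FiniteDimensional.complete ℝ F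
    exact VectorField.mlieBracket_add_left (a.contMDiff_toFun.mdifferentiable (by simp) z)
      (b.contMDiff_toFun.mdifferentiable (by simp) z)
  lie_add a b c := by
    ext1 z
    have := FiniteDimensional.complete ℝ F
    exact VectorField.mlieBracket_add_right (b.contMDiff_toFun.mdifferentiable (by simp) z)
      (c.contMDiff_toFun.mdifferentiable (by simp) z)
  lie_self a := by ext1; simp
  leibniz_lie a b c := by
    ext1 z
    have := FiniteDimensional.complete ℝ F
    have : IsManifold 𝓘(ℝ, F) (minSmoothness ℝ 3) Z := by
      rw [minSmoothness_of_isRCLikeNormedField]; infer_instance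
    have h2 : minSmoothness ℝ 2 ≤ ∞ := by
      rw [minSmoothness_of_isRCLikeNormedField]; exact ENat.LEInfty.out
    exact VectorField.leibniz_identity_mlieBracket_apply ((a.contMDiff_toFun z).of_le h2)
      ((b.contMDiff_toFun z).of_le h2) ((c.contMDiff_toFun z).of_le h2)

end InvariantField

/-! ### Sections of the reduced tangent bundle as invariant vector fields -/

theorem mk_invariantField (Y : InvariantField E F τ) {z w : Z} (h : τ z = τ w) :
    ReducedTangent.mk E F τ ⟨z, Y z⟩ = ReducedTangent.mk E F τ ⟨w, Y w⟩ := by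
  obtain ⟨t, rfl⟩ := (existsUnique_vadd E F (τ := τ) z w h).exists
  rw [← ReducedTangent.mk_translate E F τ t ⟨z, Y z⟩, tangentTranslate_mk, Y.invariant]

theorem mk_injective {z : Z} {v w : TangentSpace 𝓘(ℝ, F) z}
    (h : ReducedTangent.mk E F τ ⟨z, v⟩ = ReducedTangent.mk E F τ ⟨z, w⟩) : v = w := by
  obtain ⟨t, ht⟩ := Quotient.exact (s := orbitSetoid E F τ) h
  have h₀ : t +ᵥ z = (0 : ℝ) +ᵥ z := by
    rw [zero_vadd]; exact congrArg Bundle.TotalSpace.proj ht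
  obtain rfl := vadd_cancel E F τ h₀
  rw [tangentTranslate_zero] at ht
  simpa using ht

theorem existsUnique_representative (X : ReducedSection E F τ) (z : Z) :
    ∃! v : TangentSpace 𝓘(ℝ, F) z, ReducedTangent.mk E F τ ⟨z, v⟩ = X (τ z) := by
  obtain ⟨⟨w, u⟩, h⟩ := Quotient.exists_rep (s := orbitSetoid E F τ) (X (τ z))
  have hw : τ w = τ z := (congrArg ReducedTangent.proj h).trans (X.proj_toFun (τ z))
  obtain ⟨t, rfl⟩ := (existsUnique_vadd E F (τ := τ) w z hw).exists
  have h' : ReducedTangent.mk E F τ (tangentTranslate F t ⟨w, u⟩) = X (τ (t +ᵥ w)) :=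
    (ReducedTangent.mk_translate E F τ t _).trans h
  exact ⟨_, h', fun v hv => mk_injective (hv.trans h'.symm)⟩

/-- The unique vector at `z` which represents the value of `X` at `τ z`. -/
noncomputable def ReducedSection.representative (X : ReducedSection E F τ) (z : Z) :
    TangentSpace 𝓘(ℝ, F) z :=
  (existsUnique_representative X z).choose

theorem ReducedSection.mk_representative (X : ReducedSection E F τ) (z : Z) :
    ReducedTangent.mk E F τ ⟨z, X.representative z⟩ = X (τ z) :=
  (existsUnique_representative X z).choose_spec.1

theorem ReducedSection.representative_translate (X : ReducedSection E F τ) (t : ℝ) (z : Z) :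
    mfderiv 𝓘(ℝ, F) 𝓘(ℝ, F) (fun z : Z => t +ᵥ z) z (X.representative z) =
      X.representative (t +ᵥ z) := by
  apply mk_injective (E := E) (τ := τ)
  rw [X.mk_representative, proj_vadd E F (τ := τ), ← tangentTranslate_mk,
    ReducedTangent.mk_translate, X.mk_representative]

theorem ReducedSection.contMDiff_representative (X : ReducedSection E F τ) :
    ContMDiff 𝓘(ℝ, F) 𝓘(ℝ, F).tangent ∞
      (fun z => (⟨z, X.representative z⟩ : TangentBundle 𝓘(ℝ, F) Z)) := by
  intro z₀
  obtain ⟨U, hU, l, hl, hlX⟩ := X.smooth_toFun (τ z₀)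
  obtain ⟨e, he, he₁, -, he₃⟩ := exists_trivialization (E := E) (F := F) (τ := τ) (τ z₀)
  have hτ := contMDiff_proj (E := E) (F := F) (τ := τ)
  have hlτ : ∀ q ∈ U, τ (l q).proj = q := fun q hq =>
    (congrArg ReducedTangent.proj (hlX q hq)).trans (X.proj_toFun q)
  have hl₀ : ContMDiffAt 𝓘(ℝ, F) 𝓘(ℝ, F).tangent ∞ (fun z => l (τ z)) z₀ :=
    ((hl _ (mem_of_mem_nhds hU)).contMDiffAt hU).comp z₀ (hτ z₀)
  have hproj : ContMDiffAt 𝓘(ℝ, F) 𝓘(ℝ, F) ∞ (fun z => (l (τ z)).proj) z₀ :=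
    (Bundle.contMDiff_proj (TangentSpace 𝓘(ℝ, F))).contMDiffAt.comp z₀ hl₀
  have hes : ∀ z : Z, τ z ∈ e.baseSet → e.source ∈ nhds z := fun z hz =>
    e.open_source.mem_nhds (e.mem_source.2 hz)
  have hτl₀ : τ (l (τ z₀)).proj = τ z₀ := hlτ _ (mem_of_mem_nhds hU)
  have ha : ContMDiffAt 𝓘(ℝ, F) 𝓘(ℝ, ℝ) ∞ (fun z => (e z).2) z₀ :=
    contMDiff_snd.contMDiffAt.comp z₀ (he₁.contMDiffAt (hes z₀ he))
  have hb : ContMDiffAt 𝓘(ℝ, F) 𝓘(ℝ, ℝ) ∞ (fun z => (e (l (τ z)).proj).2) z₀ :=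
    contMDiff_snd.contMDiffAt.comp z₀ (ContMDiffAt.comp z₀
      (he₁.contMDiffAt (hes _ (by rw [hτl₀]; exact he))) hproj)
  have hc := (contMDiff_tangentTranslate E F τ).contMDiffAt.comp z₀ ((ha.sub hb).prodMk hl₀)
  refine hc.congr_of_eventuallyEq ?_
  filter_upwards [hτ.continuous.continuousAt.preimage_mem_nhds hU,
    hτ.continuous.continuousAt.preimage_mem_nhds (e.open_baseSet.mem_nhds he)] with z hz hz'
  obtain ⟨t, ht⟩ := (existsUnique_vadd E F (τ := τ) (l (τ z)).proj z (hlτ _ hz)).exists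
  have ht' : (e z).2 - (e (l (τ z)).proj).2 = t := by
    have := he₃ t (l (τ z)).proj (e.mem_source.2 (by rw [hlτ _ hz]; exact hz'))
    rw [ht] at this
    rw [this, add_sub_cancel_right]
  simp only [Function.comp_apply, ht']
  have h₁ : ∀ v : TangentBundle 𝓘(ℝ, F) Z, v.proj = z →
      ReducedTangent.mk E F τ v = X (τ z) → ⟨z, X.representative z⟩ = v := by
    rintro ⟨w, v⟩ rfl hv
    rw [mk_injective ((X.mk_representative w).trans hv.symm)]
  exact h₁ _ ht ((ReducedTangent.mk_translate E F τ t _).trans (hlX _ hz))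

theorem InvariantField.exists_lift (Y : InvariantField E F τ) (s : M → Z) (hs : ∀ p, τ (s p) = p)
    (p : M) : ∃ U ∈ nhds p, ∃ l : M → TangentBundle 𝓘(ℝ, F) Z,
      ContMDiffOn 𝓘(ℝ, E) 𝓘(ℝ, F).tangent ∞ l U ∧
      ∀ q ∈ U, ReducedTangent.mk E F τ (l q) = ReducedTangent.mk E F τ ⟨s q, Y (s q)⟩ := by
  obtain ⟨e, he, -, he₂, -⟩ := exists_trivialization (E := E) (F := F) (τ := τ) p
  refine ⟨e.baseSet, e.open_baseSet.mem_nhds he, fun q =>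
    ⟨e.toOpenPartialHomeomorph.symm (q, 0), Y (e.toOpenPartialHomeomorph.symm (q, 0))⟩, ?_, ?_⟩
  · exact Y.contMDiff_toFun.comp_contMDiffOn
      (he₂.comp (contMDiff_id.prodMk contMDiff_const).contMDiffOn
        (fun q hq => e.mem_target.2 hq))
  · intro q hq
    exact mk_invariantField Y ((e.proj_symm_apply' (x := 0) hq).trans (hs q).symm)

variable (E F τ) in
/-- The sections of the reduced tangent bundle are identified with the invariant vector fields
on `Z`: to `X` corresponds the field whose value at `z` represents `X (τ z)`. -/
noncomputable def ReducedSection.equivField : ReducedSection E F τ ≃ InvariantField E F τ where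
  toFun X :=
    { toFun := X.representative
      contMDiff_toFun := X.contMDiff_representative
      invariant := X.representative_translate }
  invFun Y :=
    { toFun := fun p => ReducedTangent.mk E F τ
        ⟨Function.surjInv (proj_surjective E F τ) p, Y (Function.surjInv (proj_surjective E F τ) p)⟩
      proj_toFun := fun p => Function.surjInv_eq (proj_surjective E F τ) p
      smooth_toFun := Y.exists_lift _ (Function.surjInv_eq (proj_surjective E F τ)) }
  left_inv X := by
    ext p
    exact (X.mk_representative _).trans (congrArg X.toFun (Function.surjInv_eq _ p))
  right_inv Y := by
    ext z
    exact mk_injective ((ReducedSection.mk_representative _ z).trans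
      (mk_invariantField Y (Function.surjInv_eq (proj_surjective E F τ) (τ z))))

/-- The value at `τ z` of the section corresponding to `Y` is the orbit of `Y z`. -/
theorem ReducedSection.equivField_symm_apply (Y : InvariantField E F τ) (z : Z) :
    (equivField E F τ).symm Y (τ z) = ReducedTangent.mk E F τ ⟨z, Y z⟩ :=
  mk_invariantField Y (Function.surjInv_eq (proj_surjective E F τ) (τ z))

/-- Addition of sections of `T̃Z`, and their multiplication by functions on `M`: orbits in the same
fibre are added by adding representatives at the same point of `Z`. -/
noncomputable instance : AddCommGroup (ReducedSection E F τ) :=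
  (ReducedSection.equivField E F τ).addCommGroup

noncomputable instance : Module C^∞⟮𝓘(ℝ, E), M; ℝ⟯ (ReducedSection E F τ) :=
  (ReducedSection.equivField E F τ).module C^∞⟮𝓘(ℝ, E), M; ℝ⟯

theorem ReducedSection.add_apply (X Y : ReducedSection E F τ) (z : Z) :
    (X + Y) (τ z) = ReducedTangent.mk E F τ ⟨z, X.representative z + Y.representative z⟩ :=
  equivField_symm_apply (equivField E F τ X + equivField E F τ Y) z

theorem ReducedSection.smul_apply (f : C^∞⟮𝓘(ℝ, E), M; ℝ⟯) (X : ReducedSection E F τ) (z : Z) :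
    (f • X) (τ z) = ReducedTangent.mk E F τ ⟨z, f (τ z) • X.representative z⟩ :=
  equivField_symm_apply (f • equivField E F τ X) z

/-- The distinguished section `X₀` of `T̃Z`, given by the fundamental vector field. -/
noncomputable def ReducedSection.fundamental : ReducedSection E F τ :=
  (ReducedSection.equivField E F τ).symm (InvariantField.fundamental E F τ)

variable [FiniteDimensional ℝ F]

/-- The Lie algebroid bracket on the sections of `T̃Z`: the bracket of the corresponding invariant
vector fields on `Z`. -/
noncomputable instance : Bracket (ReducedSection E F τ) (ReducedSection E F τ) :=
  ⟨fun X Y => (ReducedSection.equivField E F τ).symm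
    ⁅ReducedSection.equivField E F τ X, ReducedSection.equivField E F τ Y⁆⟩

theorem ReducedSection.lie_apply (X Y : ReducedSection E F τ) (z : Z) :
    ⁅X, Y⁆ (τ z) = ReducedTangent.mk E F τ
      ⟨z, VectorField.mlieBracket 𝓘(ℝ, F) X.representative Y.representative z⟩ :=
  equivField_symm_apply ⁅equivField E F τ X, equivField E F τ Y⁆ z

theorem ReducedSection.equivField_add (X Y : ReducedSection E F τ) :
    equivField E F τ (X + Y) = equivField E F τ X + equivField E F τ Y :=
  (equivField E F τ).apply_symm_apply _

theorem ReducedSection.equivField_lie (X Y : ReducedSection E F τ) :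
    equivField E F τ ⁅X, Y⁆ = ⁅equivField E F τ X, equivField E F τ Y⁆ :=
  (equivField E F τ).apply_symm_apply _

theorem ReducedSection.equivField_zero : equivField E F τ 0 = 0 :=
  (equivField E F τ).apply_symm_apply _

noncomputable instance : LieRing (ReducedSection E F τ) where
  add_lie a b c := by
    apply (ReducedSection.equivField E F τ).injective
    simp only [ReducedSection.equivField_lie, ReducedSection.equivField_add, add_lie]
  lie_add a b c := by
    apply (ReducedSection.equivField E F τ).injective
    simp only [ReducedSection.equivField_lie, ReducedSection.equivField_add, lie_add]
  lie_self a := by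
    apply (ReducedSection.equivField E F τ).injective
    simp only [ReducedSection.equivField_lie, ReducedSection.equivField_zero, lie_self]
  leibniz_lie a b c := by
    apply (ReducedSection.equivField E F τ).injective
    simp only [ReducedSection.equivField_lie, ReducedSection.equivField_add]
    exact leibniz_lie _ _ _

end Reduced

end AffineLineBundle

/-! Fix a section `σ`; one exists because convex combinations make sense in affine fibres
(`nonempty_sec`). Both sides of the correspondence then become pairs consisting of a vector field on
`M` and a smooth function. An affine derivation is determined by its linear part and its value at
`σ`, since any section is `σ` plus a function (`AffDer.ext_of_linear_eq`). Linear parts are vector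
fields on `M`, by Hadamard's lemma (`exists_vectorField_eq_derivation`). An invariant field `X` is
determined by its projection to `M` and by `X(f_σ)`: since `z = σ(τ z) - f_σ(z)`, a tangent vector
killed by `dτ` and `df_σ` is zero. Conversely, a field on `M` is lifted along `σ`
(`exists_horizontalLift`), and a multiple of the fundamental field adjusts `X(f_σ)` without changing
the projection. The map itself does not depend on this choice. As `f_σ(z + t) = f_σ(z) - t`, the
function `X(f_σ)` is constant on fibres; as `f_(σ+f) = f ∘ τ + f_σ`, it is affine in `σ` with linear
part `f ↦ X(f ∘ τ)`. Brackets match because a Lie bracket acts on functions as a commutator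
(`differential_apply_mlieBracket`) and `Y(f_σ)` is a function pulled back from `M`. Uniqueness needs
only the formula for `X(f_σ)`, since the linear part of an affine map is read off from its values.
-/

namespace AffineLineBundle

/-! ### Hadamard's lemma on a finite-dimensional space -/

section Hadamard

open MeasureTheory

universe u

variable {E : Type u} [NormedAddCommGroup E] [NormedSpace ℝ E] [FiniteDimensional ℝ E]

/-- Differentiation under the integral sign, for a smooth integrand over a compact interval. -/
theorem hasFDerivAt_intervalIntegral {W : Type*} [NormedAddCommGroup W] [NormedSpace ℝ W]
    [FiniteDimensional ℝ W] {Φ : E × ℝ → W} (hΦ : ContDiff ℝ 1 Φ) (a b : ℝ) (x : E) :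
    HasFDerivAt (fun y => ∫ t in a..b, Φ (y, t))
      (∫ t in a..b, (fderiv ℝ Φ (x, t)).comp (ContinuousLinearMap.inl ℝ E ℝ)) x := by
  have hΦ' : Continuous fun q : E × ℝ => (fderiv ℝ Φ q).comp (ContinuousLinearMap.inl ℝ E ℝ) :=
    (hΦ.continuous_fderiv one_ne_zero).clm_comp continuous_const
  -- Finite dimension makes the closed unit ball compact, so a constant dominates the derivative on
  -- ball times interval.
  obtain ⟨C, hC⟩ := ((isCompact_closedBall x 1).prod
    (isCompact_uIcc (a := a) (b := b))).exists_bound_of_continuousOn hΦ'.continuousOn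
  refine intervalIntegral.hasFDerivAt_integral_of_dominated_of_fderiv_le
    (bound := fun _ => C) (s := Metric.closedBall x 1)
    (F' := fun y t => (fderiv ℝ Φ (y, t)).comp (ContinuousLinearMap.inl ℝ E ℝ))
    (Metric.closedBall_mem_nhds x one_pos) ?_ ?_ ?_ ?_ ?_ ?_
  · exact Filter.Eventually.of_forall fun y =>
      (hΦ.continuous.comp (Continuous.prodMk_right y)).aestronglyMeasurable
  · exact (hΦ.continuous.comp (Continuous.prodMk_right x)).intervalIntegrable _ _
  · exact (hΦ'.comp (Continuous.prodMk_right x)).aestronglyMeasurable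
  · exact Filter.Eventually.of_forall fun t ht y hy => hC (y, t) ⟨hy, Set.uIoc_subset_uIcc ht⟩
  · exact intervalIntegrable_const
  · exact Filter.Eventually.of_forall fun t _ y _ =>
      ((hΦ.differentiable one_ne_zero).differentiableAt.hasFDerivAt).comp y
        (hasFDerivAt_prodMk_left y t)

/-- The derivative of the integral is the integral of the partial derivative, with values in `E
→L[ℝ] W`. The induction therefore runs over all `W` at once, and `W` shares the universe of `E` so
that this new target is admissible. -/
theorem contDiff_intervalIntegral_nat (n : ℕ) : ∀ {W : Type u} [NormedAddCommGroup W]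
    [NormedSpace ℝ W] [FiniteDimensional ℝ W] {Φ : E × ℝ → W} (_ : ContDiff ℝ ∞ Φ) (a b : ℝ),
    ContDiff ℝ n (fun y => ∫ t in a..b, Φ (y, t)) := by
  induction n with
  | zero =>
    intro W _ _ _ Φ hΦ a b
    exact contDiff_zero.2 (continuous_iff_continuousAt.2 fun x =>
      (hasFDerivAt_intervalIntegral (hΦ.of_le (by simp)) a b x).continuousAt)
  | succ n ih =>
    intro W _ _ _ Φ hΦ a b
    refine contDiff_succ_iff_hasFDerivAt.2 ⟨_, ?_,
      hasFDerivAt_intervalIntegral (hΦ.of_le (by simp)) a b⟩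
    exact ih ((hΦ.fderiv_right (m := ∞) (by simp)).clm_comp contDiff_const) a b

theorem contDiff_intervalIntegral {W : Type u} [NormedAddCommGroup W] [NormedSpace ℝ W]
    [FiniteDimensional ℝ W] {Φ : E × ℝ → W} (hΦ : ContDiff ℝ ∞ Φ) (a b : ℝ) :
    ContDiff ℝ ∞ (fun y => ∫ t in a..b, Φ (y, t)) :=
  contDiff_infty.2 fun n => contDiff_intervalIntegral_nat n hΦ a b

/-- Hadamard's lemma. -/
theorem exists_contDiff_eq_add_apply_sub {f : E → ℝ} (hf : ContDiff ℝ ∞ f) (x : E) :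
    ∃ G : E → E →L[ℝ] ℝ, ContDiff ℝ ∞ G ∧ G x = fderiv ℝ f x ∧
      ∀ y, f y = f x + G y (y - x) := by
  have hf' : ContDiff ℝ ∞ (fderiv ℝ f) := hf.fderiv_right (by simp)
  have hΦ : ContDiff ℝ ∞ fun q : E × ℝ => fderiv ℝ f (x + q.2 • (q.1 - x)) :=
    hf'.comp (contDiff_const.add (contDiff_snd.smul (contDiff_fst.sub contDiff_const)))
  -- `G y` is the mean of `fderiv ℝ f` over the segment from `x` to `y`; at `y = x` the integrand is
  -- constant.
  refine ⟨_, contDiff_intervalIntegral hΦ 0 1, by simp, fun y => ?_⟩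
  have hi : IntervalIntegrable (fun t : ℝ => fderiv ℝ f (x + t • (y - x))) volume 0 1 :=
    (hΦ.continuous.comp (Continuous.prodMk_right y)).intervalIntegrable _ _
  have hd : ∀ t : ℝ, HasDerivAt (fun t : ℝ => f (x + t • (y - x)))
      (fderiv ℝ f (x + t • (y - x)) (y - x)) t := fun t =>
    ((hf.differentiable (by simp)).differentiableAt.hasFDerivAt).comp_hasDerivAt t
      (by simpa using ((hasDerivAt_id t).smul_const (y - x)).const_add x)
  have h := intervalIntegral.integral_eq_sub_of_hasDerivAt (a := 0) (b := 1) (fun t _ => hd t)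
    (((hΦ.continuous.comp (Continuous.prodMk_right y)).clm_apply
      continuous_const).intervalIntegrable _ _)
  rw [← ContinuousLinearMap.intervalIntegral_apply hi] at h
  simp only [h]; simp

end Hadamard

/-! ### Vector fields in charts, and the Lie bracket as a commutator -/

section Manifold

open VectorField Filter Topology

variable {E : Type*} [NormedAddCommGroup E] [NormedSpace ℝ E]
  {E' : Type*} [NormedAddCommGroup E'] [NormedSpace ℝ E']
  {M : Type*} [TopologicalSpace M] [ChartedSpace E M]
  {N : Type*} [TopologicalSpace N] [ChartedSpace E' N]

variable (E) in
/-- The differential of a real function, with values in `ℝ` instead of a tangent space of `ℝ`. -/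
noncomputable def differential (g : M → ℝ) (p : M) : TangentSpace 𝓘(ℝ, E) p →L[ℝ] ℝ :=
  mfderiv 𝓘(ℝ, E) 𝓘(ℝ, ℝ) g p

theorem differential_congr {f g : M → ℝ} {p : M} (h : f =ᶠ[𝓝 p] g) :
    differential E f p = differential E g p :=
  h.mfderiv_eq

theorem differential_comp {g : M → ℝ} {f : N → M} {q : N}
    (hg : MDifferentiableAt 𝓘(ℝ, E) 𝓘(ℝ, ℝ) g (f q))
    (hf : MDifferentiableAt 𝓘(ℝ, E') 𝓘(ℝ, E) f q) (v : TangentSpace 𝓘(ℝ, E') q) :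
    differential E' (g ∘ f) q v =
      differential E g (f q) (mfderiv 𝓘(ℝ, E') 𝓘(ℝ, E) f q v) :=
  mfderiv_comp_apply q hg hf v

theorem differential_eq_fderiv (g : E → ℝ) (x v : E) : differential E g x v = fderiv ℝ g x v :=
  DFunLike.congr_fun (mfderiv_eq_fderiv (f := g) (x := x)) v

variable [IsManifold 𝓘(ℝ, E) ∞ M]

theorem contMDiff_differential_apply {g : M → ℝ} (hg : ContMDiff 𝓘(ℝ, E) 𝓘(ℝ, ℝ) ∞ g)
    {V : ∀ p : M, TangentSpace 𝓘(ℝ, E) p}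
    (hV : ContMDiff 𝓘(ℝ, E) 𝓘(ℝ, E).tangent ∞
      (fun p => (⟨p, V p⟩ : TangentBundle 𝓘(ℝ, E) M))) :
    ContMDiff 𝓘(ℝ, E) 𝓘(ℝ, ℝ) ∞ (fun p => differential E g p (V p)) :=
  (contMDiff_snd_tangentBundle_modelSpace ℝ 𝓘(ℝ, ℝ)).comp
    ((hg.contMDiff_tangentMap (m := ∞) le_rfl).comp hV)

/-- A vector field, written in the chart centred at `p`. -/
noncomputable def fieldInChart (p : M) (V : ∀ p : M, TangentSpace 𝓘(ℝ, E) p) : E → E :=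
  mpullbackWithin 𝓘(ℝ, E) 𝓘(ℝ, E) (extChartAt 𝓘(ℝ, E) p).symm V (Set.range 𝓘(ℝ, E))

/-- The tangent space at `p` is identified with `E` through the chart at `p` itself, so the
coordinate expression at the centre is the vector unchanged. -/
theorem fieldInChart_center (p : M) (V : ∀ p : M, TangentSpace 𝓘(ℝ, E) p) :
    fieldInChart p V (extChartAt 𝓘(ℝ, E) p p) = V p := by
  have : IsManifold 𝓘(ℝ, E) 1 M := IsManifold.of_le (n := ∞) (by exact ENat.LEInfty.out)
  have h : ∀ q, q = p → (V q : E) = V p := by rintro q rfl; rfl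
  exact (mfderivWithin_extChartAt_symm_inverse_apply (x := p)
    (V ((extChartAt 𝓘(ℝ, E) p).symm (extChartAt 𝓘(ℝ, E) p p)) : E)).trans
    (h _ (extChartAt_to_inv p))

theorem differentiableAt_fieldInChart [CompleteSpace E] (p : M)
    {V : ∀ p : M, TangentSpace 𝓘(ℝ, E) p}
    (hV : ContMDiff 𝓘(ℝ, E) 𝓘(ℝ, E).tangent ∞
      (fun p => (⟨p, V p⟩ : TangentBundle 𝓘(ℝ, E) M))) :
    DifferentiableAt ℝ (fieldInChart p V) (extChartAt 𝓘(ℝ, E) p p) := by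
  have : IsManifold 𝓘(ℝ, E) 2 M := IsManifold.of_le (n := ∞) (by exact ENat.LEInfty.out)
  have := (hV.mdifferentiable (by simp) p).mdifferentiableWithinAt
    (s := Set.univ) |>.differentiableWithinAt_mpullbackWithin_vectorField
  rw [Set.preimage_univ, Set.univ_inter] at this
  exact differentiableWithinAt_univ.1 (this.mono (ModelWithCorners.range_eq_univ 𝓘(ℝ, E)).ge)

theorem mdifferentiableAt_extChartAt_symm_of_mem (p : M) {y : E}
    (hy : y ∈ (extChartAt 𝓘(ℝ, E) p).target) :
    MDifferentiableAt 𝓘(ℝ, E) 𝓘(ℝ, E) (extChartAt 𝓘(ℝ, E) p).symm y :=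
  ((contMDiffOn_extChartAt_symm (n := ∞) p).contMDiffAt
    ((isOpen_extChartAt_target p).mem_nhds hy)).mdifferentiableAt (by simp)

theorem fderiv_comp_apply_fieldInChart (p : M) {g : M → ℝ}
    (hg : ContMDiff 𝓘(ℝ, E) 𝓘(ℝ, ℝ) ∞ g) (V : ∀ p : M, TangentSpace 𝓘(ℝ, E) p) {y : E}
    (hy : y ∈ (extChartAt 𝓘(ℝ, E) p).target) :
    fderiv ℝ (g ∘ (extChartAt 𝓘(ℝ, E) p).symm) y (fieldInChart p V y) =
      differential E g ((extChartAt 𝓘(ℝ, E) p).symm y) (V ((extChartAt 𝓘(ℝ, E) p).symm y)) := by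
  have : IsManifold 𝓘(ℝ, E) 1 M := IsManifold.of_le (n := ∞) (by exact ENat.LEInfty.out)
  have hi := isInvertible_mfderivWithin_extChartAt_symm (I := 𝓘(ℝ, E)) hy
  have hg' : MDifferentiableAt 𝓘(ℝ, E) 𝓘(ℝ, ℝ) g ((extChartAt 𝓘(ℝ, E) p).symm y) :=
    hg.mdifferentiable (by simp) _
  have h := differential_comp hg' (mdifferentiableAt_extChartAt_symm_of_mem p hy)
    (fieldInChart (E := E) p V y)
  have h' : mfderiv 𝓘(ℝ, E) 𝓘(ℝ, E) (extChartAt 𝓘(ℝ, E) p).symm y (fieldInChart (E := E) p V y) =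
      V ((extChartAt 𝓘(ℝ, E) p).symm y) := by
    rw [← mfderivWithin_univ, ← ModelWithCorners.range_eq_univ 𝓘(ℝ, E)]
    exact hi.self_apply_inverse _
  exact (differential_eq_fderiv _ _ _).symm.trans (h.trans (congrArg _ h'))

/-- The field `fun _ => u` serves only for its value at `p`; the preceding chain rule asks for no
regularity of the field. -/
theorem fderiv_comp_extChartAt_symm (p : M) {g : M → ℝ}
    (hg : ContMDiff 𝓘(ℝ, E) 𝓘(ℝ, ℝ) ∞ g) (u : E) :
    fderiv ℝ (g ∘ (extChartAt 𝓘(ℝ, E) p).symm) (extChartAt 𝓘(ℝ, E) p p) u =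
      differential E g p u := by
  have h := fderiv_comp_apply_fieldInChart p hg (fun _ => u) (mem_extChartAt_target p)
  rw [fieldInChart_center p (fun _ => u)] at h
  have h' : ∀ q, q = p → (differential E g q u = differential E g p u) := by rintro q rfl; rfl
  exact h.trans (h' _ (extChartAt_to_inv p))

/-- The Lie bracket of vector fields acts on functions as a commutator. -/
theorem differential_apply_mlieBracket [CompleteSpace E] {g : M → ℝ}
    (hg : ContMDiff 𝓘(ℝ, E) 𝓘(ℝ, ℝ) ∞ g) {V W : ∀ p : M, TangentSpace 𝓘(ℝ, E) p}
    (hV : ContMDiff 𝓘(ℝ, E) 𝓘(ℝ, E).tangent ∞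
      (fun p => (⟨p, V p⟩ : TangentBundle 𝓘(ℝ, E) M)))
    (hW : ContMDiff 𝓘(ℝ, E) 𝓘(ℝ, E).tangent ∞
      (fun p => (⟨p, W p⟩ : TangentBundle 𝓘(ℝ, E) M))) (p : M) :
    differential E g p (mlieBracket 𝓘(ℝ, E) V W p) =
      differential E (fun q => differential E g q (W q)) p (V p) -
      differential E (fun q => differential E g q (V q)) p (W p) := by
  have : IsManifold 𝓘(ℝ, E) 1 M := IsManifold.of_le (n := ∞) (by exact ENat.LEInfty.out)
  have hsmooth : ContDiffAt ℝ ∞ (g ∘ (extChartAt 𝓘(ℝ, E) p).symm) (extChartAt 𝓘(ℝ, E) p p) :=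
    (hg.contMDiffAt.comp _ ((contMDiffOn_extChartAt_symm (n := ∞) p).contMDiffAt
      (extChartAt_target_mem_nhds p))).contDiffAt
  have key := fderiv_apply_lieBracket (n := ∞) hsmooth
    (by rw [minSmoothness_of_isRCLikeNormedField]; exact ENat.LEInfty.out)
    (differentiableAt_fieldInChart p hW) (differentiableAt_fieldInChart p hV)
  have hev : ∀ (U : ∀ p : M, TangentSpace 𝓘(ℝ, E) p),
      (fun y => fderiv ℝ (g ∘ (extChartAt 𝓘(ℝ, E) p).symm) y (fieldInChart p U y))
        =ᶠ[𝓝 (extChartAt 𝓘(ℝ, E) p p)]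
      (fun q => differential E g q (U q)) ∘ (extChartAt 𝓘(ℝ, E) p).symm := fun U => by
    filter_upwards [extChartAt_target_mem_nhds (I := 𝓘(ℝ, E)) p] with y hy using
      fderiv_comp_apply_fieldInChart p hg U hy
  rw [(hev V).fderiv_eq, (hev W).fderiv_eq,
    fderiv_comp_extChartAt_symm p (contMDiff_differential_apply hg hV),
    fderiv_comp_extChartAt_symm p (contMDiff_differential_apply hg hW),
    fderiv_comp_extChartAt_symm p hg, fieldInChart_center, fieldInChart_center] at key
  refine Eq.trans (congrArg _ ?_) key
  -- The manifold bracket is the bracket of the chart expressions pulled back by the chart, whose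
  -- derivative at its own centre is the identity.
  rw [← mlieBracketWithin_univ, mlieBracketWithin_apply, Set.preimage_univ, Set.univ_inter]
  refine (congrArg (fun L : E →L[ℝ] E => L.inverse _)
    (mfderiv_extChartAt_self (I := 𝓘(ℝ, E)) (x := p))).trans ?_
  refine (DFunLike.congr_fun (ContinuousLinearMap.inverse_id (R := ℝ) (M := E)) _).trans ?_
  refine Eq.trans (congrArg (fun s => lieBracketWithin ℝ (fieldInChart p V) (fieldInChart p W) s
    (extChartAt 𝓘(ℝ, E) p p)) (ModelWithCorners.range_eq_univ 𝓘(ℝ, E))) ?_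
  exact congrFun lieBracketWithin_univ _

end Manifold

/-! ### Derivations of smooth functions are vector fields -/

section Derivation

open Filter Topology

variable {E : Type*} [NormedAddCommGroup E] [NormedSpace ℝ E] [FiniteDimensional ℝ E]
  {M : Type*} [TopologicalSpace M] [ChartedSpace E M] [IsManifold 𝓘(ℝ, E) ∞ M] [T2Space M]

theorem exists_eventuallyEq_comp_extChartAt (p : M) {h : E → ℝ} (hh : ContDiff ℝ ∞ h) :
    ∃ f : C^∞⟮𝓘(ℝ, E), M; ℝ⟯, f =ᶠ[𝓝 p] h ∘ extChartAt 𝓘(ℝ, E) p := by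
  obtain ⟨χ⟩ : Nonempty (SmoothBumpFunction 𝓘(ℝ, E) p) := inferInstance
  refine ⟨⟨fun q => χ q • (h ∘ extChartAt 𝓘(ℝ, E) p) q,
    χ.contMDiff_smul (hh.contMDiff.comp_contMDiffOn (contMDiffOn_extChartAt))⟩, ?_⟩
  filter_upwards [χ.eventuallyEq_one] with q hq
  simp [hq]

/-- Hadamard's lemma is stated for functions on all of `E`, so the chart expression of `f` is cut
off by a bump supported in a closed ball inside the chart target. -/
theorem exists_contDiff_comp_extChartAt_eventuallyEq (p : M) (f : C^∞⟮𝓘(ℝ, E), M; ℝ⟯) :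
    ∃ h : E → ℝ, ContDiff ℝ ∞ h ∧ f =ᶠ[𝓝 p] h ∘ extChartAt 𝓘(ℝ, E) p := by
  set φ := extChartAt 𝓘(ℝ, E) p with hφ
  obtain ⟨r, hr, hrt⟩ := Metric.nhds_basis_closedBall.mem_iff.1
    (extChartAt_target_mem_nhds (I := 𝓘(ℝ, E)) p)
  let χ : ContDiffBump (φ p) := ⟨r / 2, r, by positivity, by linarith⟩
  refine ⟨fun y => χ y * f (φ.symm y), ?_, ?_⟩
  · rw [contDiff_iff_contDiffAt]
    intro y
    by_cases hy : y ∈ tsupport χ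
    · rw [χ.tsupport_eq] at hy
      exact χ.contDiffAt.mul (f.contMDiff.contMDiffAt.comp y
        ((contMDiffOn_extChartAt_symm (n := ∞) p).contMDiffAt
          ((isOpen_extChartAt_target p).mem_nhds (hrt hy)))).contDiffAt
    · refine (contDiffAt_const (c := (0 : ℝ))).congr_of_eventuallyEq ?_
      filter_upwards [notMem_tsupport_iff_eventuallyEq.1 hy] with z hz
      simp [hz]
  · filter_upwards [extChartAt_source_mem_nhds (I := 𝓘(ℝ, E)) p,
      (continuousAt_extChartAt (I := 𝓘(ℝ, E)) p).eventually χ.eventuallyEq_one] with q hq hq'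
    simp only [Function.comp_apply]
    rw [hq', φ.left_inv hq]
    simp

theorem differential_eq_fderiv_extChartAt {p q : M} (hq : q ∈ (chartAt E p).source) {h : E → ℝ}
    (hh : ContDiff ℝ ∞ h) {f : M → ℝ} (hf : f =ᶠ[𝓝 q] h ∘ extChartAt 𝓘(ℝ, E) p)
    (v : TangentSpace 𝓘(ℝ, E) q) :
    differential E f q v = fderiv ℝ h (extChartAt 𝓘(ℝ, E) p q)
      (mfderiv 𝓘(ℝ, E) 𝓘(ℝ, E) (extChartAt 𝓘(ℝ, E) p) q v) := by
  have : IsManifold 𝓘(ℝ, E) 1 M := IsManifold.of_le (n := ∞) (by exact ENat.LEInfty.out)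
  rw [differential_congr hf, differential_comp
    (hh.contMDiff.mdifferentiable (by simp) _) (mdifferentiableAt_extChartAt hq)]
  exact differential_eq_fderiv _ _ _

theorem differential_eq_fderiv_extChartAt_center {p : M} {h : E → ℝ}
    (hh : ContDiff ℝ ∞ h) {f : M → ℝ} (hf : f =ᶠ[𝓝 p] h ∘ extChartAt 𝓘(ℝ, E) p) (v : E) :
    differential E f p v = fderiv ℝ h (extChartAt 𝓘(ℝ, E) p p) v := by
  have : IsManifold 𝓘(ℝ, E) 1 M := IsManifold.of_le (n := ∞) (by exact ENat.LEInfty.out)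
  refine (differential_eq_fderiv_extChartAt (mem_chart_source E p) hh hf v).trans ?_
  rw [mfderiv_extChartAt_self]
  rfl

/-- Chart coordinates, cut off to global functions, already separate tangent vectors. -/
theorem eq_of_forall_differential_eq {p : M} {v w : TangentSpace 𝓘(ℝ, E) p}
    (h : ∀ f : C^∞⟮𝓘(ℝ, E), M; ℝ⟯, differential E f p v = differential E f p w) : v = w := by
  let b := Module.finBasis ℝ E
  refine b.ext_elem (x := v) (y := w) fun i => ?_
  have hb : ContDiff ℝ ∞ (b.coord i).toContinuousLinearMap := ContinuousLinearMap.contDiff _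
  obtain ⟨f, hf⟩ := exists_eventuallyEq_comp_extChartAt p hb
  have := (differential_eq_fderiv_extChartAt_center hb hf v).symm.trans
    ((h f).trans (differential_eq_fderiv_extChartAt_center hb hf w))
  rw [ContinuousLinearMap.fderiv] at this
  exact this

variable (D : Derivation ℝ C^∞⟮𝓘(ℝ, E), M; ℝ⟯ C^∞⟮𝓘(ℝ, E), M; ℝ⟯)

/-- With a bump `χ` supported where `f = g` and `χ p = 1`, the product `χ (f - g)` vanishes
identically, and Leibniz at `p` reduces its derivation to `D f p - D g p`. -/
theorem derivation_congr {p : M} {f g : C^∞⟮𝓘(ℝ, E), M; ℝ⟯} (h : f =ᶠ[𝓝 p] g) :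
    D f p = D g p := by
  obtain ⟨χ, -, hχ⟩ := (SmoothBumpFunction.nhds_basis_support (I := 𝓘(ℝ, E)) h).mem_iff.1 h
  let X : C^∞⟮𝓘(ℝ, E), M; ℝ⟯ := ⟨χ, χ.contMDiff⟩
  have h₀ : X * (f - g) = 0 := by
    ext q
    by_cases hq : q ∈ Function.support χ
    · have : f q = g q := hχ hq
      simp [this]
    · have : X q = 0 := Function.notMem_support.1 hq
      simp [this]
  have h₁ := congrArg (fun u : C^∞⟮𝓘(ℝ, E), M; ℝ⟯ => u p) (D.leibniz X (f - g))
  have h₂ : X p = 1 := χ.eq_one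
  have h₃ : f p = g p := h.self_of_nhds
  rw [h₀] at h₁
  simp [h₂, h₃] at h₁
  linarith

/-- In coordinates `x i` centred at `p`, Hadamard gives `f = f p + ∑ g i * x i` near `p`. As `x i p
= 0`, Leibniz leaves `∑ g i p * D (x i) p`, where `g i p` is the `i`-th partial derivative; so the
vector has components `D (x i) p`. -/
theorem exists_differential_eq_derivation (p : M) : ∃ v : TangentSpace 𝓘(ℝ, E) p,
    ∀ f : C^∞⟮𝓘(ℝ, E), M; ℝ⟯, D f p = differential E f p v := by
  set φ := extChartAt 𝓘(ℝ, E) p with hφ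
  let b := Module.finBasis ℝ E
  have hb : ∀ i, ContDiff ℝ ∞ (fun y => (b.coord i).toContinuousLinearMap (y - φ p)) := fun i =>
    (ContinuousLinearMap.contDiff _).comp (contDiff_id.sub contDiff_const)
  choose x hx using fun i => exists_eventuallyEq_comp_extChartAt p (hb i)
  refine ⟨∑ i, (D (x i) p : ℝ) • b i, fun f => ?_⟩
  obtain ⟨h, hh, hfh⟩ := exists_contDiff_comp_extChartAt_eventuallyEq p f
  obtain ⟨G, hG, hGp, hhG⟩ := exists_contDiff_eq_add_apply_sub hh (φ p)
  have hGb : ∀ i, ContDiff ℝ ∞ (fun y => G y (b i)) := fun i => hG.clm_apply contDiff_const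
  choose g hg using fun i => exists_eventuallyEq_comp_extChartAt p (hGb i)
  have hev : ∀ (s : Finset (Fin (Module.finrank ℝ E))) (u : _ → C^∞⟮𝓘(ℝ, E), M; ℝ⟯) (q : M),
    (∑ i ∈ s, u i) q = ∑ i ∈ s, u i q := fun s u q =>
      map_sum (ContMDiffMap.evalRingHom (I := 𝓘(ℝ, E)) (n := ∞) (R := ℝ) q) u s
  have hf : f =ᶠ[𝓝 p] (algebraMap ℝ C^∞⟮𝓘(ℝ, E), M; ℝ⟯ (f p) + ∑ i, g i * x i :
      C^∞⟮𝓘(ℝ, E), M; ℝ⟯) := by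
    filter_upwards [hfh, eventually_all.2 hx, eventually_all.2 hg] with q hq hxq hgq
    have h₁ : f p = h (φ p) := hfh.self_of_nhds
    rw [ContMDiffMap.coe_add, Pi.add_apply, hev, hq, Function.comp_apply, hhG]
    have h₂ : ∑ i, (g i * x i) q = G (φ q) (∑ i, b.repr (φ q - φ p) i • b i) := by
      simp only [map_sum, map_smul, ContMDiffMap.coe_mul, Pi.mul_apply, hxq, hgq, smul_eq_mul]
      exact Finset.sum_congr rfl fun i _ => mul_comm _ _
    rw [h₂, b.sum_repr]
    congr 1
    exact h₁.symm
  refine Eq.trans ?_ ((differential_eq_fderiv_extChartAt_center hh hfh _).trans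
    (map_sum (fderiv ℝ h (φ p)) _ _)).symm
  rw [derivation_congr D hf, map_add, Derivation.map_algebraMap, zero_add, map_sum, hev]
  refine Finset.sum_congr rfl fun i _ => ?_
  have h₁ : x i p = 0 := by rw [(hx i).self_of_nhds]; simp [hφ]
  have h₂ : g i p = fderiv ℝ h (φ p) (b i) := (hg i).self_of_nhds.trans (DFunLike.congr_fun hGp (b i))
  rw [map_smul, Derivation.leibniz]
  simp [h₁, h₂, mul_comm]

/-- Every derivation of the algebra of smooth functions is given by a smooth vector field. -/
theorem exists_vectorField_eq_derivation : ∃ V : ∀ p : M, TangentSpace 𝓘(ℝ, E) p,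
    ContMDiff 𝓘(ℝ, E) 𝓘(ℝ, E).tangent ∞ (fun p => (⟨p, V p⟩ : TangentBundle 𝓘(ℝ, E) M)) ∧
    ∀ (f : C^∞⟮𝓘(ℝ, E), M; ℝ⟯) (p : M), D f p = differential E f p (V p) := by
  have : IsManifold 𝓘(ℝ, E) 1 M := IsManifold.of_le (n := ∞) (by exact ENat.LEInfty.out)
  choose V hV using exists_differential_eq_derivation D
  refine ⟨V, fun p => ?_, fun f p => hV p f⟩
  rw [Bundle.contMDiffAt_section]
  let b := Module.finBasis ℝ E
  -- The coordinates are not recentred here: one family `x i` serves all `q` near `p`, and the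
  -- components of `V q` in the chart at `p` are the smooth functions `D (x i)`.
  have hb : ∀ i, ContDiff ℝ ∞ (b.coord i).toContinuousLinearMap := fun i =>
    ContinuousLinearMap.contDiff _
  choose x hx using fun i => exists_eventuallyEq_comp_extChartAt p (hb i)
  have hsum : ContMDiffAt 𝓘(ℝ, E) 𝓘(ℝ, E) ∞ (fun q => ∑ i, (D (x i) q : ℝ) • b i) p :=
    ContMDiffAt.sum fun i _ => (D (x i)).contMDiff.contMDiffAt.smul contMDiffAt_const
  refine hsum.congr_of_eventuallyEq ?_
  -- The differential at `q` sees the germ at `q`, hence the agreement is needed on a neighbourhood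
  -- of each nearby `q`.
  filter_upwards [chart_source_mem_nhds E p,
    eventually_all.2 fun i => (hx i).eventually_nhds] with q hq hxq
  have h₁ : (trivializationAt E (TangentSpace 𝓘(ℝ, E)) p ⟨q, V q⟩).2 =
      mfderiv 𝓘(ℝ, E) 𝓘(ℝ, E) (extChartAt 𝓘(ℝ, E) p) q (V q) := by
    rw [← TangentBundle.continuousLinearMapAt_trivializationAt hq]
    exact (Bundle.Trivialization.continuousLinearMapAt_apply_of_mem ℝ _
      (by simpa using hq) _).symm
  rw [h₁]
  refine (b.sum_repr _).symm.trans (Finset.sum_congr rfl fun i _ => ?_)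
  rw [hV, differential_eq_fderiv_extChartAt hq (hb i) (hxq i), ContinuousLinearMap.fderiv]
  rfl

end Derivation

/-! ### Rules of calculus for the real-valued differential -/

section Differential

variable {E : Type*} [NormedAddCommGroup E] [NormedSpace ℝ E]
  {M : Type*} [TopologicalSpace M] [ChartedSpace E M] {f g : M → ℝ} {p : M}

theorem differential_add (hf : MDifferentiableAt 𝓘(ℝ, E) 𝓘(ℝ, ℝ) f p)
    (hg : MDifferentiableAt 𝓘(ℝ, E) 𝓘(ℝ, ℝ) g p) :
    differential E (f + g) p = differential E f p + differential E g p :=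
  (hf.hasMFDerivAt.add hg.hasMFDerivAt).mfderiv

theorem differential_mul_apply (hf : MDifferentiableAt 𝓘(ℝ, E) 𝓘(ℝ, ℝ) f p)
    (hg : MDifferentiableAt 𝓘(ℝ, E) 𝓘(ℝ, ℝ) g p) (v : TangentSpace 𝓘(ℝ, E) p) :
    differential E (f * g) p v = f p * differential E g p v + g p * differential E f p v :=
  DFunLike.congr_fun (hf.hasMFDerivAt.mul hg.hasMFDerivAt).mfderiv v

theorem differential_const (c : ℝ) : differential E (fun _ : M => c) p = 0 :=
  mfderiv_const

theorem differential_add_const (hf : MDifferentiableAt 𝓘(ℝ, E) 𝓘(ℝ, ℝ) f p) (c : ℝ) :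
    differential E (fun q => f q + c) p = differential E f p := by
  have := differential_add hf (mdifferentiableAt_const (c := c))
  rwa [differential_const, add_zero] at this

end Differential

/-! ### Fibre differences, existence of sections, affine functions -/

section Bundle

open Filter Topology

variable {E F : Type*} [NormedAddCommGroup E] [NormedSpace ℝ E]
  [NormedAddCommGroup F] [NormedSpace ℝ F]
  {M Z : Type*} [TopologicalSpace M] [ChartedSpace E M] [TopologicalSpace Z] [ChartedSpace F Z]
  [AddAction ℝ Z] {τ : Z → M}

variable (E F τ) in
theorem diff_vadd_left [AffineLineBundle E F τ] (t : ℝ) {w z : Z} (h : τ z = τ w) :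
    diff (t +ᵥ w) z = t + diff w z :=
  diff_eq E F τ (by rw [add_vadd, diff_vadd E F τ h])

variable (E F τ) in
theorem diff_add_diff [AffineLineBundle E F τ] {x y z : Z} (h : τ z = τ y) (h' : τ y = τ x) :
    diff x y + diff y z = diff x z :=
  (diff_eq E F τ (by rw [add_vadd, diff_vadd E F τ h, diff_vadd E F τ h'])).symm

variable (E F τ) in
-- In an affine trivialization the fibre difference is the difference of the fibre coordinates.
theorem contMDiffAt_diff [AffineLineBundle E F τ] {E' N : Type*} [NormedAddCommGroup E']
    [NormedSpace ℝ E'] [TopologicalSpace N] [ChartedSpace E' N] {a b : N → Z} {x : N}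
    (ha : ContMDiffAt 𝓘(ℝ, E') 𝓘(ℝ, F) ∞ a x) (hb : ContMDiffAt 𝓘(ℝ, E') 𝓘(ℝ, F) ∞ b x)
    (hab : ∀ᶠ y in 𝓝 x, τ (b y) = τ (a y)) :
    ContMDiffAt 𝓘(ℝ, E') 𝓘(ℝ, ℝ) ∞ (fun y => diff (a y) (b y)) x := by
  obtain ⟨e, he, he₁, -, he₃⟩ := exists_trivialization (E := E) (F := F) (τ := τ) (τ (a x))
  have hax : e.source ∈ 𝓝 (a x) := e.open_source.mem_nhds (e.mem_source.2 he)
  have hbx : e.source ∈ 𝓝 (b x) := e.open_source.mem_nhds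
    (e.mem_source.2 (by rw [hab.self_of_nhds]; exact he))
  have h₁ : ContMDiffAt 𝓘(ℝ, E') 𝓘(ℝ, ℝ) ∞ (fun y => (e (a y)).2 - (e (b y)).2) x :=
    (contMDiff_snd.contMDiffAt.comp x ((he₁.contMDiffAt hax).comp x ha)).sub
      (contMDiff_snd.contMDiffAt.comp x ((he₁.contMDiffAt hbx).comp x hb))
  refine h₁.congr_of_eventuallyEq ?_
  filter_upwards [hab, hb.continuousAt hbx] with y hy hy'
  have := he₃ (diff (a y) (b y)) (b y) hy'
  rw [diff_vadd E F τ hy] at this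
  rw [this, add_sub_cancel_right]

variable (E F τ) in
-- Local sections are glued by taking their barycentre with partition-of-unity weights, written
-- relative to an origin in each fibre.
theorem nonempty_sec [AffineLineBundle E F τ] [FiniteDimensional ℝ E] [IsManifold 𝓘(ℝ, E) ∞ M]
    [T2Space M] [SigmaCompactSpace M] : Nonempty (Sec E F τ) := by
  choose e he _ he₂ _ using exists_trivialization (E := E) (F := F) (τ := τ)
  obtain ⟨ρ, hρ⟩ := SmoothPartitionOfUnity.exists_isSubordinate 𝓘(ℝ, E) isClosed_univ
    (fun p => (e p).baseSet) (fun p => (e p).open_baseSet)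
    (fun p _ => Set.mem_iUnion.2 ⟨p, he p⟩)
  let s : M → M → Z := fun i q => (e i).toOpenPartialHomeomorph.symm (q, 0)
  have hs' : ∀ i, ContMDiffOn 𝓘(ℝ, E) 𝓘(ℝ, F) ∞ (s i) (e i).baseSet := fun i =>
    (he₂ i).comp (contMDiff_id.prodMk contMDiff_const).contMDiffOn
      (fun q hq => (e i).mem_target.2 hq)
  have hs : ∀ i, ∀ q ∈ (e i).baseSet, ContMDiffAt 𝓘(ℝ, E) 𝓘(ℝ, F) ∞ (s i) q := fun i q hq =>
    (hs' i).contMDiffAt ((e i).open_baseSet.mem_nhds hq)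
  have hτs : ∀ i, ∀ q ∈ (e i).baseSet, τ (s i q) = q := fun i q hq => (e i).proj_symm_apply' hq
  have hsupp : ∀ i q, ρ i q ≠ 0 → q ∈ (e i).baseSet := fun i q hq =>
    hρ i (subset_tsupport _ hq)
  -- An arbitrary origin in each fibre, with no continuity; for smoothness near `p` it is exchanged
  -- for the local section `s p`.
  let r := Function.surjInv (proj_surjective E F τ)
  have hr : ∀ q, τ (r q) = q := Function.surjInv_eq (proj_surjective E F τ)
  -- the barycenter of the local sections is independent of the origin
  have key : ∀ q z, τ z = q → (∑ᶠ i, ρ i q • diff (s i q) z : ℝ) +ᵥ z =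
      (∑ᶠ i, ρ i q • diff (s i q) (r q) : ℝ) +ᵥ r q := by
    intro q z hz
    have hzr : τ (r q) = τ z := by rw [hr, hz]
    -- Changing the origin shifts every difference by `diff z (r q)`, and the weights sum to one.
    have h₁ : (∑ᶠ i, ρ i q • diff (s i q) (r q) : ℝ) =
        (∑ᶠ i, ρ i q • diff (s i q) z : ℝ) + diff z (r q) := by
      rw [← ρ.sum_finsupport_smul_eq_finsum q (fun i q => diff (s i q) (r q)),
        ← ρ.sum_finsupport_smul_eq_finsum q (fun i q => diff (s i q) z)]
      have h₂ : ∀ i ∈ ρ.finsupport q, ρ i q • diff (s i q) (r q) =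
          ρ i q • diff (s i q) z + ρ i q * diff z (r q) := by
        intro i hi
        have hi' := hsupp i q (by simpa using hi)
        rw [← diff_add_diff E F τ hzr (by rw [hτs i q hi', hz]), smul_eq_mul, smul_eq_mul, mul_add]
      rw [Finset.sum_congr rfl h₂, Finset.sum_add_distrib, ← Finset.sum_mul,
        ρ.sum_finsupport q (Set.mem_univ q), one_mul]
    rw [h₁, add_vadd, diff_vadd E F τ hzr]
  refine ⟨⟨fun q => (∑ᶠ i, ρ i q • diff (s i q) (r q) : ℝ) +ᵥ r q,
    fun q => by rw [proj_vadd E F (τ := τ), hr], fun p => ?_⟩⟩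
  have hsm : ContMDiffAt 𝓘(ℝ, E) 𝓘(ℝ, ℝ) ∞ (fun q => ∑ᶠ i, ρ i q • diff (s i q) (s p q)) p := by
    refine ρ.contMDiffAt_finsum fun i hi => contMDiffAt_diff E F τ (hs i p (hρ i hi))
      (hs p p (he p)) ?_
    filter_upwards [(e i).open_baseSet.mem_nhds (hρ i hi),
      (e p).open_baseSet.mem_nhds (he p)] with q hq hq'
    rw [hτs i q hq, hτs p q hq']
  refine ((contMDiff_vadd (E := E) (F := F) (τ := τ)).contMDiffAt.comp p
    (hsm.prodMk (hs p p (he p)))).congr_of_eventuallyEq ?_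
  filter_upwards [(e p).open_baseSet.mem_nhds (he p)] with q hq
  exact (key q (s p q) (hτs p q hq)).symm

namespace Sec

variable [AffineLineBundle E F τ] (σ : Sec E F τ)

theorem exists_vadd_eq (σ σ' : Sec E F τ) : ∃ f : C^∞⟮𝓘(ℝ, E), M; ℝ⟯, f +ᵥ σ = σ' :=
  ⟨⟨fun p => diff (σ' p) (σ p), fun p => contMDiffAt_diff E F τ (σ'.contMDiff_toFun p)
      (σ.contMDiff_toFun p) (Eventually.of_forall fun q => by
        rw [σ.proj_toFun, σ'.proj_toFun])⟩,
    Sec.ext fun p => diff_vadd E F τ (by rw [σ.proj_toFun, σ'.proj_toFun])⟩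

theorem contMDiff_affineFunction : ContMDiff 𝓘(ℝ, F) 𝓘(ℝ, ℝ) ∞ σ.affineFunction := fun _ =>
  contMDiffAt_diff E F τ
    ((σ.contMDiff_toFun.comp (contMDiff_proj (E := E) (F := F) (τ := τ))).contMDiffAt)
    contMDiffAt_id (Eventually.of_forall fun w => (σ.proj_toFun (τ w)).symm)

theorem affineFunction_vadd_self (z : Z) : σ.affineFunction z +ᵥ z = σ (τ z) :=
  diff_vadd E F τ (σ.proj_toFun (τ z)).symm

theorem neg_affineFunction_vadd (z : Z) : (-σ.affineFunction z) +ᵥ σ (τ z) = z := by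
  rw [← σ.affineFunction_vadd_self, vadd_vadd, neg_add_cancel, zero_vadd]

theorem affineFunction_translate (t : ℝ) (z : Z) :
    σ.affineFunction (t +ᵥ z) = σ.affineFunction z + -t :=
  diff_eq E F τ (by
    rw [proj_vadd E F (τ := τ), vadd_vadd, neg_add_cancel_right, affineFunction_vadd_self])

theorem affineFunction_apply_self (p : M) : σ.affineFunction (σ p) = 0 :=
  diff_eq E F τ (by rw [σ.proj_toFun, zero_vadd])

/-- This is what makes `σ ↦ X(f_σ)` affine, with linear part `f ↦ X(f ∘ τ)`. -/
theorem affineFunction_vadd (f : C^∞⟮𝓘(ℝ, E), M; ℝ⟯) :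
    (f +ᵥ σ).affineFunction = f ∘ τ + σ.affineFunction :=
  funext fun z => diff_vadd_left E F τ _ (σ.proj_toFun (τ z)).symm

/-- A tangent vector of `Z` is determined by its projection to `M` and by its action on the affine
function of a section. -/
theorem eq_zero_of_mfderiv_proj_eq_zero {z : Z} {v : TangentSpace 𝓘(ℝ, F) z}
    (h : mfderiv 𝓘(ℝ, F) 𝓘(ℝ, E) τ z v = 0) (h' : differential F σ.affineFunction z v = 0) :
    v = 0 := by
  have hτ := contMDiff_proj (E := E) (F := F) (τ := τ)
  have h₁ : ContMDiff 𝓘(ℝ, F) 𝓘(ℝ, ℝ) ∞ (fun w => -σ.affineFunction w) :=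
    contDiff_neg.contMDiff.comp σ.contMDiff_affineFunction
  have h₂ := σ.contMDiff_toFun.comp hτ
  have h₃ : mfderiv 𝓘(ℝ, F) 𝓘(ℝ, ℝ) (fun z => -σ.affineFunction z) z v = 0 :=
    (mfderiv_comp_apply (I' := 𝓘(ℝ, ℝ)) z
      (contDiff_neg.contMDiff.mdifferentiable (n := ∞) (by simp) _)
      (σ.contMDiff_affineFunction.mdifferentiable (by simp) z) v).trans
      ((congrArg _ h').trans (map_zero _))
  have h₄ : mfderiv 𝓘(ℝ, F) 𝓘(ℝ, F) (σ.toFun ∘ τ) z v = 0 :=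
    (mfderiv_comp_apply z (σ.contMDiff_toFun.mdifferentiable (by simp) _)
      (hτ.mdifferentiable (by simp) z) v).trans ((congrArg _ h).trans (map_zero _))
  -- The identity of `Z` factors through `(-f_σ, σ ∘ τ)`, both of whose derivatives kill `v`.
  have hid : (fun p : ℝ × Z => p.1 +ᵥ p.2) ∘
      (fun z => (-σ.affineFunction z, (σ.toFun ∘ τ) z)) = id :=
    funext σ.neg_affineFunction_vadd
  have h₅ := mfderiv_comp_apply z
    ((contMDiff_vadd (E := E) (F := F) (τ := τ)).mdifferentiable (by simp) _)
    ((h₁.prodMk h₂).mdifferentiable (by simp) z) v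
  have h₆ : mfderiv 𝓘(ℝ, F) (𝓘(ℝ, ℝ).prod 𝓘(ℝ, F))
      (fun z => (-σ.affineFunction z, (σ.toFun ∘ τ) z)) z v = 0 := by
    rw [mfderiv_prodMk (h₁.mdifferentiable (by simp) z) (h₂.mdifferentiable (by simp) z)]
    exact Prod.ext h₃ h₄
  have h₇ : (mfderiv 𝓘(ℝ, F) 𝓘(ℝ, F) (id : Z → Z) z v : F) = (0 : F) := by
    rw [← hid]
    exact h₅.trans ((congrArg _ h₆).trans (map_zero _))
  rw [mfderiv_id] at h₇
  exact h₇

end Sec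

variable (E F τ) in
theorem contMDiffMap_ext_of_proj [AffineLineBundle E F τ] {f g : C^∞⟮𝓘(ℝ, E), M; ℝ⟯}
    (h : ∀ z, f (τ z) = g (τ z)) : f = g :=
  ContMDiffMap.ext fun p => by
    obtain ⟨z, rfl⟩ := proj_surjective E F τ p
    exact h z

theorem AffDer.ext_of_linear_eq [AffineLineBundle E F τ] {D D' : AffDer E F τ}
    (h : D.linear = D'.linear) (σ : Sec E F τ) (hσ : D σ = D' σ) : D = D' :=
  AffDer.ext (fun σ' => by
    obtain ⟨f, rfl⟩ := σ.exists_vadd_eq σ'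
    rw [D.map_vadd, D'.map_vadd, h, hσ]) h

/-- The linear part is recovered as `D (f +ᵥ σ) - D σ`, which requires some section to exist. -/
theorem AffDer.ext_of_toFun_eq [AffineLineBundle E F τ] [Nonempty (Sec E F τ)]
    {D D' : AffDer E F τ} (h : ∀ σ, D σ = D' σ) : D = D' :=
  AffDer.ext h (Derivation.ext fun f => by
    obtain ⟨σ⟩ := ‹Nonempty (Sec E F τ)›
    have h₁ := h (f +ᵥ σ)
    rw [D.map_vadd, D'.map_vadd, h σ] at h₁
    exact add_right_cancel h₁)

end Bundle

/-! ### From invariant vector fields to affine derivations and back -/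

section Correspondence

open Filter Topology

variable {E F : Type*} [NormedAddCommGroup E] [NormedSpace ℝ E]
  [NormedAddCommGroup F] [NormedSpace ℝ F]
  {M Z : Type*} [TopologicalSpace M] [ChartedSpace E M] [TopologicalSpace Z] [ChartedSpace F Z]
  [IsManifold 𝓘(ℝ, F) ∞ Z]
  [AddAction ℝ Z] {τ : Z → M} [AffineLineBundle E F τ]

namespace InvariantField

variable (X Y : InvariantField E F τ)

/-- An invariant vector field maps a function which is invariant up to constants to an invariant
function. -/
theorem differential_eq_of_proj_eq {g : Z → ℝ} (hg : ContMDiff 𝓘(ℝ, F) 𝓘(ℝ, ℝ) ∞ g) {c : ℝ → ℝ}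
    (hc : ∀ t z, g (t +ᵥ z) = g z + c t) {z w : Z} (h : τ z = τ w) :
    differential F g z (X z) = differential F g w (X w) := by
  obtain ⟨t, rfl⟩ := (existsUnique_vadd E F (τ := τ) z w h).exists
  -- Differentiate `g (t +ᵥ z) = g z + c t` along `X`: the left side moves to the translated point
  -- by invariance, and the constant drops out.
  have h₁ := differential_comp (hg.mdifferentiable (by simp) _)
    ((contMDiff_translate E F τ t).mdifferentiable (by simp) z) (X z)
  rw [X.invariant] at h₁
  rw [← h₁, ← differential_add_const (hg.mdifferentiable (by simp) z) (c t)]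
  exact congrArg (fun g => differential F g z (X z)) (funext fun z => (hc t z).symm)

theorem differential_affineFunction (σ : Sec E F τ) {z w : Z} (h : τ z = τ w) :
    differential F σ.affineFunction z (X z) = differential F σ.affineFunction w (X w) :=
  X.differential_eq_of_proj_eq σ.contMDiff_affineFunction σ.affineFunction_translate h

theorem contMDiff_comp_proj (f : C^∞⟮𝓘(ℝ, E), M; ℝ⟯) : ContMDiff 𝓘(ℝ, F) 𝓘(ℝ, ℝ) ∞ (f ∘ τ) :=
  f.contMDiff.comp (contMDiff_proj (E := E) (F := F) (τ := τ))

theorem differential_comp_proj (f : C^∞⟮𝓘(ℝ, E), M; ℝ⟯) {z w : Z} (h : τ z = τ w) :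
    differential F (f ∘ τ) z (X z) = differential F (f ∘ τ) w (X w) :=
  X.differential_eq_of_proj_eq (c := 0) (contMDiff_comp_proj f)
    (fun t z => by simp [proj_vadd E F (τ := τ)]) h

theorem differential_comp_proj_apply (f : C^∞⟮𝓘(ℝ, E), M; ℝ⟯) (z : Z)
    (v : TangentSpace 𝓘(ℝ, F) z) :
    differential F (f ∘ τ) z v = differential E f (τ z) (mfderiv 𝓘(ℝ, F) 𝓘(ℝ, E) τ z v) :=
  differential_comp (f.contMDiff.mdifferentiable (by simp) _)
    ((contMDiff_proj (E := E) (F := F) (τ := τ)).mdifferentiable (by simp) z) v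

/-- The smooth function `X(f_σ)`, as a function on `M`. -/
noncomputable def applySec (σ : Sec E F τ) : C^∞⟮𝓘(ℝ, E), M; ℝ⟯ :=
  ⟨fun p => differential F σ.affineFunction (σ p) (X (σ p)),
    (contMDiff_differential_apply σ.contMDiff_affineFunction X.contMDiff_toFun).comp
      σ.contMDiff_toFun⟩

theorem applySec_proj (σ : Sec E F τ) (z : Z) :
    X.applySec σ (τ z) = differential F σ.affineFunction z (X z) :=
  X.differential_affineFunction σ (σ.proj_toFun (τ z))

/-- The smooth function `X(f ∘ τ)`, as a function on `M`. The section `σ` is auxiliary. -/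
noncomputable def applyFun (σ : Sec E F τ) (f : C^∞⟮𝓘(ℝ, E), M; ℝ⟯) : C^∞⟮𝓘(ℝ, E), M; ℝ⟯ :=
  ⟨fun p => differential F (f ∘ τ) (σ p) (X (σ p)),
    (contMDiff_differential_apply (contMDiff_comp_proj f) X.contMDiff_toFun).comp
      σ.contMDiff_toFun⟩

theorem applyFun_proj (σ : Sec E F τ) (f : C^∞⟮𝓘(ℝ, E), M; ℝ⟯) (z : Z) :
    X.applyFun σ f (τ z) = differential F (f ∘ τ) z (X z) :=
  X.differential_comp_proj f (σ.proj_toFun (τ z))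

theorem mdifferentiableAt_comp_proj (f : C^∞⟮𝓘(ℝ, E), M; ℝ⟯) (z : Z) :
    MDifferentiableAt 𝓘(ℝ, F) 𝓘(ℝ, ℝ) (f ∘ τ) z :=
  (contMDiff_comp_proj f).mdifferentiable (by simp) z

/-- The derivation of `C^∞(M)` induced by an invariant vector field. -/
noncomputable def toDerivation (σ : Sec E F τ) :
    Derivation ℝ C^∞⟮𝓘(ℝ, E), M; ℝ⟯ C^∞⟮𝓘(ℝ, E), M; ℝ⟯ :=
  Derivation.mk'
    { toFun := X.applyFun σ
      map_add' := fun f g => contMDiffMap_ext_of_proj E F τ fun z => by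
        rw [ContMDiffMap.coe_add, Pi.add_apply, applyFun_proj, applyFun_proj, applyFun_proj]
        exact DFunLike.congr_fun (differential_add (mdifferentiableAt_comp_proj (τ := τ) f z)
          (mdifferentiableAt_comp_proj (τ := τ) g z)) (X z)
      map_smul' := fun c f => contMDiffMap_ext_of_proj E F τ fun z => by
        rw [RingHom.id_apply, ContMDiffMap.coe_smul, Pi.smul_apply, applyFun_proj, applyFun_proj]
        have h := differential_mul_apply (mdifferentiableAt_const (c := c))
          (mdifferentiableAt_comp_proj (τ := τ) f z) (X z)
        rw [differential_const, _root_.zero_apply, mul_zero, add_zero] at h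
        exact h }
    fun f g => contMDiffMap_ext_of_proj E F τ fun z => by
      have h := differential_mul_apply (mdifferentiableAt_comp_proj (τ := τ) f z)
        (mdifferentiableAt_comp_proj (τ := τ) g z) (X z)
      rw [← X.applyFun_proj σ, ← X.applyFun_proj σ] at h
      exact (X.applyFun_proj σ _ z).trans h

theorem toDerivation_proj (σ : Sec E F τ) (f : C^∞⟮𝓘(ℝ, E), M; ℝ⟯) (z : Z) :
    X.toDerivation σ f (τ z) = differential F (f ∘ τ) z (X z) :=
  X.applyFun_proj σ f z

variable [Nonempty (Sec E F τ)]

/-- The affine derivation `σ ↦ X(f_σ)` given by an invariant vector field. -/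
noncomputable def toAffDer : AffDer E F τ where
  toFun := X.applySec
  -- The chosen section is immaterial: it only supplies a point in each fibre, and `X(f ∘ τ)` is
  -- constant on fibres.
  linear := X.toDerivation (Classical.arbitrary _)
  map_vadd f σ := contMDiffMap_ext_of_proj E F τ fun z => by
    rw [ContMDiffMap.coe_add, Pi.add_apply, toDerivation_proj, applySec_proj, applySec_proj,
      Sec.affineFunction_vadd, differential_add (mdifferentiableAt_comp_proj (τ := τ) f z)
        (σ.contMDiff_affineFunction.mdifferentiable (by simp) z)]
    rfl

theorem toAffDer_proj (σ : Sec E F τ) (z : Z) :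
    X.toAffDer σ (τ z) = differential F σ.affineFunction z (X z) :=
  X.applySec_proj σ z

theorem toAffDer_linear_proj (f : C^∞⟮𝓘(ℝ, E), M; ℝ⟯) (z : Z) :
    X.toAffDer.linear f (τ z) = differential F (f ∘ τ) z (X z) :=
  X.toDerivation_proj _ f z

theorem toAffDer_add : (X + Y).toAffDer = X.toAffDer + Y.toAffDer :=
  AffDer.ext_of_toFun_eq fun σ => contMDiffMap_ext_of_proj E F τ fun z => by
    rw [AffDer.add_toFun, ContMDiffMap.coe_add, Pi.add_apply, toAffDer_proj, toAffDer_proj,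
      toAffDer_proj, add_apply, map_add]

theorem toAffDer_smul (f : C^∞⟮𝓘(ℝ, E), M; ℝ⟯) : (f • X).toAffDer = f • X.toAffDer :=
  AffDer.ext_of_toFun_eq fun σ => contMDiffMap_ext_of_proj E F τ fun z => by
    rw [AffDer.smul_toFun, ContMDiffMap.coe_mul, Pi.mul_apply, toAffDer_proj, toAffDer_proj,
      smul_apply, map_smul, smul_eq_mul]

/-- The commutator formula gives `X(Y(f_σ)) - Y(X(f_σ))`. Here `Y(f_σ)` and `X(f_σ)` are pullbacks
from `M`, on which invariant fields act through the linear parts. -/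
theorem toAffDer_lie [FiniteDimensional ℝ F] : ⁅X, Y⁆.toAffDer = ⁅X.toAffDer, Y.toAffDer⁆ :=
  AffDer.ext_of_toFun_eq fun σ => contMDiffMap_ext_of_proj E F τ fun z => by
    have := FiniteDimensional.complete ℝ F
    rw [toAffDer_proj, lie_apply, differential_apply_mlieBracket σ.contMDiff_affineFunction
      X.contMDiff_toFun Y.contMDiff_toFun, AffDer.lie_toFun, ContMDiffMap.coe_sub, Pi.sub_apply,
      toAffDer_linear_proj, toAffDer_linear_proj]
    simp only [← toAffDer_proj]
    rfl

/-- Equal linear parts give equal projections to `M`, as functions separate tangent vectors there;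
equal values at one `σ` make the difference kill `f_σ` as well. -/
theorem toAffDer_injective [FiniteDimensional ℝ E] [IsManifold 𝓘(ℝ, E) ∞ M] [T2Space M] :
    Function.Injective (fun X : InvariantField E F τ => X.toAffDer) := by
  intro X Y (h : X.toAffDer = Y.toAffDer)
  obtain ⟨σ⟩ := ‹Nonempty (Sec E F τ)›
  ext z
  refine sub_eq_zero.1 (σ.eq_zero_of_mfderiv_proj_eq_zero ?_ ?_)
  · rw [map_sub, sub_eq_zero]
    refine eq_of_forall_differential_eq fun f => ?_
    rw [← differential_comp_proj_apply, ← differential_comp_proj_apply, ← toAffDer_linear_proj,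
      ← toAffDer_linear_proj, h]
  · rw [map_sub, ← toAffDer_proj, ← toAffDer_proj, h, sub_self]

theorem differential_fundamental {g : Z → ℝ} (hg : ContMDiff 𝓘(ℝ, F) 𝓘(ℝ, ℝ) ∞ g) (z : Z) :
    differential F g z (fundamental E F τ z) = deriv (fun t : ℝ => g ((-t) +ᵥ z)) 0 := by
  have h₁ : MDifferentiableAt 𝓘(ℝ, ℝ) 𝓘(ℝ, F) (fun s : ℝ => (-s) +ᵥ z) 0 :=
    ((contMDiff_vadd (E := E) (F := F) (τ := τ)).comp
      (contDiff_neg.contMDiff.prodMk contMDiff_const :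
        ContMDiff 𝓘(ℝ, ℝ) (𝓘(ℝ, ℝ).prod 𝓘(ℝ, F)) ∞
        (fun s : ℝ => (-s, z)))).mdifferentiable (by simp) 0
  have h₂ := differential_comp (hg.mdifferentiable (by simp) _) h₁ (1 : ℝ)
  have h₃ : ∀ w : Z, w = z → ∀ v : F, differential F g z v = differential F g w v := by
    rintro w rfl v; rfl
  exact (h₃ ((-0 : ℝ) +ᵥ z) (by simp) _).trans
    (h₂.symm.trans ((differential_eq_fderiv _ _ _).trans fderiv_apply_one_eq_deriv))

/-- Moving by `-t` raises `f_σ` by `t`, so the derivative is one; this fixes the sign in the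
fundamental field. -/
theorem toAffDer_fundamental (σ : Sec E F τ) : (fundamental E F τ).toAffDer σ = 1 :=
  contMDiffMap_ext_of_proj E F τ fun z => by
    rw [toAffDer_proj, differential_fundamental σ.contMDiff_affineFunction]
    simp [Sec.affineFunction_translate]

theorem toAffDer_fundamental_linear : (fundamental E F τ).toAffDer.linear = 0 :=
  Derivation.ext fun f => contMDiffMap_ext_of_proj E F τ fun z => by
    rw [toAffDer_linear_proj, differential_fundamental (contMDiff_comp_proj f)]
    simp [proj_vadd E F (τ := τ)]

/-- There is an invariant vector field on `Z` whose value along a section `σ` is the image under `σ` of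
a given vector field on `M`. -/
theorem exists_horizontalLift [IsManifold 𝓘(ℝ, E) ∞ M] (σ : Sec E F τ)
    {V : ∀ p : M, TangentSpace 𝓘(ℝ, E) p}
    (hV : ContMDiff 𝓘(ℝ, E) 𝓘(ℝ, E).tangent ∞
      (fun p => (⟨p, V p⟩ : TangentBundle 𝓘(ℝ, E) M))) :
    ∃ X : InvariantField E F τ, ∀ p, X (σ p) = mfderiv 𝓘(ℝ, E) 𝓘(ℝ, F) σ p (V p) := by
  -- The classes of the vectors `Tσ(V p)` form a section of the quotient with a global smooth lift;
  -- its invariant field spreads them over the fibres by translation.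
  let H : ReducedSection E F τ :=
    { toFun := fun p => ReducedTangent.mk E F τ (tangentMap 𝓘(ℝ, E) 𝓘(ℝ, F) σ ⟨p, V p⟩)
      proj_toFun := σ.proj_toFun
      smooth_toFun := fun p => ⟨Set.univ, univ_mem,
        fun q => tangentMap 𝓘(ℝ, E) 𝓘(ℝ, F) σ ⟨q, V q⟩,
        ((σ.contMDiff_toFun.contMDiff_tangentMap (m := ∞) le_rfl).comp hV).contMDiffOn,
        fun _ _ => rfl⟩ }
  refine ⟨ReducedSection.equivField E F τ H, fun p => mk_injective
    ((H.mk_representative (σ p)).trans (congrArg H.toFun (σ.proj_toFun p)))⟩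

/-- The preimage of `D` is the lift along `σ` of the vector field of `D.linear`, plus `D σ` times
the fundamental field. -/
theorem toAffDer_surjective [FiniteDimensional ℝ E] [IsManifold 𝓘(ℝ, E) ∞ M] [T2Space M] :
    Function.Surjective (fun X : InvariantField E F τ => X.toAffDer) := by
  intro D
  obtain ⟨σ⟩ := ‹Nonempty (Sec E F τ)›
  obtain ⟨V, hV, hDV⟩ := exists_vectorField_eq_derivation D.linear
  obtain ⟨X, hX⟩ := exists_horizontalLift σ hV
  have hσ : ∀ p, MDifferentiableAt 𝓘(ℝ, E) 𝓘(ℝ, F) σ p :=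
    σ.contMDiff_toFun.mdifferentiable (by simp)
  -- Along `σ` the lift is tangent to the image of `σ`, on which `f_σ` vanishes.
  have hXσ : X.toAffDer σ = 0 := by
    ext p
    have h₁ := X.toAffDer_proj σ (σ p)
    have h₂ := differential_comp (σ.contMDiff_affineFunction.mdifferentiable (by simp) _)
      (hσ p) (V p)
    have h₃ : σ.affineFunction ∘ σ = fun _ => 0 := funext σ.affineFunction_apply_self
    rw [hX, ← h₂, h₃, differential_const, σ.proj_toFun] at h₁
    exact h₁
  have hXl : X.toAffDer.linear = D.linear := by
    ext f p
    have h₁ := X.toAffDer_linear_proj f (σ p)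
    have h₂ := differential_comp (mdifferentiableAt_comp_proj (τ := τ) f _) (hσ p) (V p)
    have h₃ : (f ∘ τ) ∘ σ = f := funext fun p => congrArg f (σ.proj_toFun p)
    rw [hX, ← h₂, h₃, ← hDV, σ.proj_toFun] at h₁
    exact h₁
  -- The fundamental field has zero linear part and value `1` at `σ`, so this term corrects the
  -- value only.
  refine ⟨X + D σ • fundamental E F τ, AffDer.ext_of_linear_eq ?_ σ ?_⟩
  · beta_reduce
    rw [toAffDer_add, toAffDer_smul, AffDer.add_linear, AffDer.smul_linear,
      toAffDer_fundamental_linear, smul_zero, add_zero, hXl]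
  · beta_reduce
    rw [toAffDer_add, toAffDer_smul, AffDer.add_toFun, AffDer.smul_toFun, toAffDer_fundamental,
      hXσ, mul_one, zero_add]

end InvariantField

variable (E F τ) in
/-- The isomorphism from the sections of the reduced tangent bundle onto the affine derivations. -/
noncomputable def ReducedSection.equivAffDer [Nonempty (Sec E F τ)] [FiniteDimensional ℝ E]
    [IsManifold 𝓘(ℝ, E) ∞ M] [T2Space M] :
    ReducedSection E F τ ≃ₗ[C^∞⟮𝓘(ℝ, E), M; ℝ⟯] AffDer E F τ :=
  -- Linearity is inherited from `toAffDer`, because the module structure on sections is transported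
  -- along `equivField`.
  LinearEquiv.ofBijective
    { toFun := fun X => (equivField E F τ X).toAffDer
      map_add' := fun X Y => by
        rw [← InvariantField.toAffDer_add]
        exact congrArg (fun Y : InvariantField E F τ => Y.toAffDer)
          ((equivField E F τ).apply_symm_apply (equivField E F τ X + equivField E F τ Y))
      map_smul' := fun f X => by
        rw [RingHom.id_apply, ← InvariantField.toAffDer_smul]
        exact congrArg (fun Y : InvariantField E F τ => Y.toAffDer)
          ((equivField E F τ).apply_symm_apply (f • equivField E F τ X)) }
    (Function.Bijective.comp (g := fun X : InvariantField E F τ => X.toAffDer)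
      ⟨InvariantField.toAffDer_injective, InvariantField.toAffDer_surjective⟩
      (equivField E F τ).bijective)

theorem ReducedSection.equivAffDer_apply [Nonempty (Sec E F τ)] [FiniteDimensional ℝ E]
    [IsManifold 𝓘(ℝ, E) ∞ M] [T2Space M] (X : ReducedSection E F τ) :
    equivAffDer E F τ X = (equivField E F τ X).toAffDer :=
  rfl

end Correspondence

end AffineLineBundle
-- The isomorphism and its uniqueness
theorem theorem1 {E F M Z : Type*}
    [NormedAddCommGroup E] [NormedSpace ℝ E] [FiniteDimensional ℝ E]
    [NormedAddCommGroup F] [NormedSpace ℝ F] [FiniteDimensional ℝ F]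
    [TopologicalSpace M] [ChartedSpace E M] [IsManifold 𝓘(ℝ, E) ∞ M] [T2Space M]
    [SigmaCompactSpace M]
    [TopologicalSpace Z] [ChartedSpace F Z] [IsManifold 𝓘(ℝ, F) ∞ Z]
    [AddAction ℝ Z] (τ : Z → M) [AffineLineBundle E F τ] :
    ∃! Φ : AffineLineBundle.ReducedSection E F τ ≃ₗ[C^∞⟮𝓘(ℝ, E), M; ℝ⟯]
        AffineLineBundle.AffDer E F τ,
      (∀ X Y, Φ ⁅X, Y⁆ = ⁅Φ X, Φ Y⁆) ∧
      (∀ X (σ : AffineLineBundle.Sec E F τ) (z : Z) (v : TangentSpace 𝓘(ℝ, F) z),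
        AffineLineBundle.ReducedTangent.mk E F τ ⟨z, v⟩ = X (τ z) →
          Φ X σ (τ z) = mfderiv 𝓘(ℝ, F) 𝓘(ℝ, ℝ) σ.affineFunction z v) ∧
      (∀ X (f : C^∞⟮𝓘(ℝ, E), M; ℝ⟯) (p : M),
        (Φ X).linear f p = mfderiv 𝓘(ℝ, E) 𝓘(ℝ, ℝ) f (X p).anchor.proj (X p).anchor.2) ∧
      (∀ σ : AffineLineBundle.Sec E F τ, Φ AffineLineBundle.ReducedSection.fundamental σ = 1) ∧
      (Φ AffineLineBundle.ReducedSection.fundamental).linear = 0 := by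

  have := AffineLineBundle.nonempty_sec E F τ
  refine ⟨AffineLineBundle.ReducedSection.equivAffDer E F τ, ⟨fun X Y => ?_, ?_, ?_, ?_, ?_⟩, ?_⟩
  · rw [AffineLineBundle.ReducedSection.equivAffDer_apply,
      AffineLineBundle.ReducedSection.equivField_lie, AffineLineBundle.InvariantField.toAffDer_lie]
    rfl
  · intro X σ z v h
    -- The action on `Z` is free, so an orbit has one representative over each `z`, and `v` must be
    -- it.
    obtain rfl := AffineLineBundle.mk_injective ((X.mk_representative z).trans h.symm)
    exact (AffineLineBundle.ReducedSection.equivField E F τ X).toAffDer_proj σ z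
  · intro X f p
    obtain ⟨z, rfl⟩ := AffineLineBundle.proj_surjective E F τ p
    rw [← X.mk_representative z]
    exact ((AffineLineBundle.ReducedSection.equivField E F τ X).toAffDer_linear_proj f z).trans
      (AffineLineBundle.InvariantField.differential_comp_proj_apply f z _)
  · intro σ
    rw [AffineLineBundle.ReducedSection.equivAffDer_apply,
      AffineLineBundle.ReducedSection.fundamental, Equiv.apply_symm_apply]
    exact AffineLineBundle.InvariantField.toAffDer_fundamental σ
  · rw [AffineLineBundle.ReducedSection.equivAffDer_apply,
      AffineLineBundle.ReducedSection.fundamental, Equiv.apply_symm_apply]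
    exact AffineLineBundle.InvariantField.toAffDer_fundamental_linear
  -- The formula for `X(f_σ)` alone fixes all values of `Ψ X`, and with them its linear part.
  · rintro Ψ ⟨-, hΨ, -⟩
    refine LinearEquiv.ext fun X => AffineLineBundle.AffDer.ext_of_toFun_eq fun σ =>
      AffineLineBundle.contMDiffMap_ext_of_proj E F τ fun z => ?_
    exact (hΨ X σ z _ (X.mk_representative z)).trans
      ((AffineLineBundle.ReducedSection.equivField E F τ X).toAffDer_proj σ z).symm
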